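/- Let $\mathbb{C}\{t,z]]$ be the ring of formal power series $\sum_{n\ge 0}a_n z^n$ whose coefficients $a_n=a_n(t_1,\dots,t_m)$ are all holomorphic on one common neighbourhood of $0\in\mathbb{C}^m$. A formal $(TE)$-structure $\nabla$ of rank $r$ over $(\mathbb{C}^m,0)$ is a connection form $\sum_i z^{-1}A_i\,dt_i+z^{-2}B\,dz$ with $A_i,B\in M_{r\times r}(\mathbb{C}\{t,z]])$ which is flat: $$z\partial_iA_j-z\partial_jA_i+[A_i,A_j]=0,\qquad z\partial_iB-z^2\partial_zA_i+zA_i+[A_i,B]=0 .$$ A formal isomorphism between $\nabla=(A_i,B)$ and $\tilde\nabla=(\tilde A_i,\tilde B)$ which covers a biholomorphic germ $h=(h^1,\dots,h^m):(\mathbb{C}^m,0)\to(\mathbb{C}^m,0)$ is a matrix $T=\sum_{n\ge0}T^{(n)}z^n\in M_{r\times r}(\mathbb{C}\{t,z]])$ with $T^{(0)}(0)$ invertible such that $\tilde T:=T\circ h$ satisfies $$z\partial_i\tilde T+\sum_j(\partial_ih^j)(A_j\circ h)\tilde T-\tilde T\tilde A_i=0\ \ \forall i,\qquad z^2\partial_z\tilde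 T+(B\circ h)\tilde T-\tilde T\tilde B=0 .$$ It is a formal gauge isomorphism if $h=\mathrm{id}$. $\nabla$ and $\tilde\nabla$ are formally (gauge) isomorphic if there is a formal (gauge) isomorphism between them. Let $m=r=2$, $C_1=\mathrm{Id}_2$, $C_2=\begin{pmatrix}0&0\\1&0\end{pmatrix}$, $D=\begin{pmatrix}1&0\\0&-1\end{pmatrix}$, $E=\begin{pmatrix}0&1\\0&0\end{pmatrix}$. The *formal normal forms* are the following formal $(TE)$-structures over $(\mathbb{C}^2,0)$, all with $A_1=C_1$, where $c,\alpha,c_0,\gamma\in\mathbb{C}$ and $\beta:=-t_1+c+\alpha z$: (i) $A_2=C_2+zE$, $\ B=\beta C_1+(-\tfrac{t_2}{2}+c_0)C_2-\tfrac z4D+z(-\tfrac{t_2}{2}+c_0)E$; (ii) for $r\in\mathbb{Z}_{\ge1}$: $A_2=C_2+zt_2^rE$, $\ B=\beta C_1-\tfrac{t_2}{r+2}C_2-\tfrac{z(r+1)}{2(r+2)}D-\tfrac{zt_2^{r+1}}{r+2}E$; (iii) $A_2=C_2$ and $B$ one of 1. $\beta C_1-\tfrac z2D$; 2. $\beta C_1+t_2^2C_2-z(t_2+\tfrac12)D-z^2E$;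 3. $\beta C_1+\lambda t_2C_2-\tfrac z2(\lambda+1)D$, with $\lambda\in\mathbb{C}$, $\lambda\notin\mathbb{Z}\setminus\{0\}$; 4. $\beta C_1+(\lambda t_2+1)C_2-\tfrac z2(\lambda+1)D$, with $\lambda\in\mathbb{C}$, $\lambda\notin\mathbb{Z}\setminus\{0\}$; 5. $\beta C_1+(\lambda t_2+1+\gamma t_2^2z^\lambda)C_2-\tfrac z2(\lambda+1+2\gamma t_2z^\lambda)D-\gamma z^{\lambda+2}E$, with $\lambda\in\mathbb{Z}_{\ge1}$; 6. $\beta C_1+t_2(\lambda+t_2z^\lambda)C_2-\tfrac z2(\lambda+1+2t_2z^\lambda)D-z^{\lambda+2}E$, with $\lambda\in\mathbb{Z}_{\ge1}$; 7. $\beta C_1+\lambda t_2C_2-\tfrac z2(\lambda+1)D$, with $\lambda\in\mathbb{Z}_{\ge1}$; 8. $\beta C_1+(\lambda t_2+z^{-\lambda})C_2-\tfrac z2(\lambda+1)D$, with $\lambda\in\mathbb{Z}_{\le-1}$; 9. $\beta C_1+\lambda t_2C_2-\tfrac z2(\lambda+1)D$, with $\lambda\in\mathbb{Z}_{\le-1}$.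 **Theorem.** Any two distinct $(TE)$-structures $\nabla$, $\tilde\nabla$ in formal normal form are formally non-isomorphic, except when: (a) both are of the form (i), with constants $c,\alpha,c_0$ and $\tilde c,\tilde\alpha,\tilde c_0$, and $c_0\tilde c_0\ne0$. Then (being distinct) they are formally isomorphic if and only if $\tilde c=c$, $\tilde\alpha=\alpha$ and $\tilde c_0=-c_0$, and they are not formally gauge isomorphic; (b) both are of the form (iii.4), with constants $c,\alpha,\lambda$ and $\tilde c,\tilde\alpha,\tilde\lambda$, and $\lambda\tilde\lambda\neq0$. Then (being distinct) they are formally isomorphic if and only if $\tilde c=c$, $\tilde\alpha=\alpha$ and $\tilde\lambda=-\lambda$, and they are not formally gauge isomorphic. -/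

import Mathlib

open scoped Topology

noncomputable section

namespace TEStruct

/-- Formal power series in `z` whose coefficients are functions of `t = (t₁, …, t_m)`. -/
abbrev FSeries (m : ℕ) : Type := PowerSeries ((Fin m → ℂ) → ℂ)

/-- Square matrices of size `r` with entries in `FSeries m`. -/
abbrev FMat (m r : ℕ) : Type := Matrix (Fin r) (Fin r) (FSeries m)

/-- The matrix has entries in `ℂ{t, z]]`: all coefficients of all entries are holomorphic
on the same neighbourhood of the origin. -/
def IsHol {m r : ℕ} (F : FMat m r) : Prop :=
  ∃ U ∈ 𝓝 (0 : Fin m → ℂ), ∀ a b n, AnalyticOnNhd ℂ (PowerSeries.coeff n (F a b)) U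

/-- Equality over the germ `(ℂ^m, 0)`: all coefficients agree as germs at the origin. -/
def GermEq {m r : ℕ} (F G : FMat m r) : Prop :=
  ∀ a b n, PowerSeries.coeff n (F a b) =ᶠ[𝓝 (0 : Fin m → ℂ)] PowerSeries.coeff n (G a b)

/-- The partial derivative `∂_i f` of a function of `t`. -/
def pdFun {m : ℕ} (i : Fin m) (f : (Fin m → ℂ) → ℂ) : (Fin m → ℂ) → ℂ :=
  fun t => fderiv ℂ f t (Pi.single i 1)

/-- `∂_i` on power series in `z`, coefficient by coefficient. -/
def pdSeries {m : ℕ} (i : Fin m) (f : FSeries m) : FSeries m :=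
  PowerSeries.mk fun n => pdFun i (PowerSeries.coeff n f)

/-- `∂_i` on matrices, entry by entry. -/
def pd {m r : ℕ} (i : Fin m) (F : FMat m r) : FMat m r := F.map (pdSeries i)

/-- `∂_z` on matrices, entry by entry. -/
def dz {m r : ℕ} (F : FMat m r) : FMat m r := F.map fun f => PowerSeries.derivative _ f

/-- `F ∘ h`, where `h` acts on the variable `t` only. -/
def pullback {m r : ℕ} (F : FMat m r) (h : (Fin m → ℂ) → (Fin m → ℂ)) : FMat m r :=
  F.map fun f => PowerSeries.mk fun n => PowerSeries.coeff n f ∘ h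

/-- The variable `z`. -/
def zz (m : ℕ) : FSeries m := PowerSeries.X

/-- The coordinate function `t_i` (numbered from `0`). -/
def tt {m : ℕ} (i : Fin m) : FSeries m := PowerSeries.C fun t => t i

/-- Complex constants. -/
def kk {m : ℕ} (c : ℂ) : FSeries m := PowerSeries.C fun _ => c

/-- A formal `(TE)`-structure of rank `r` over `(ℂ^m, 0)`, on the trivial bundle, given by the
connection form `∑ z⁻¹ A_i dt_i + z⁻² B dz` with `A_i`, `B` matrices over `ℂ{t, z]]`,
which is flat. -/
structure FormalTE (m r : ℕ) where
  A : Fin m → FMat m r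
  B : FMat m r
  hol_A : ∀ i, IsHol (A i)
  hol_B : IsHol B
  flat_A : ∀ i j, GermEq
    (zz m • pd i (A j) - zz m • pd j (A i) + (A i * A j - A j * A i)) 0
  flat_B : ∀ i, GermEq
    (zz m • pd i B - zz m ^ 2 • dz (A i) + zz m • A i + (A i * B - B * A i)) 0

/-- Two formal `(TE)`-structures over `(ℂ^m, 0)` are the same: their connection forms agree as
germs. -/
def FormalTE.Same {m r : ℕ} (N N' : FormalTE m r) : Prop :=
  (∀ i, GermEq (N.A i) (N'.A i)) ∧ GermEq N.B N'.B

/-- `h` is (a representative of) a biholomorphic map germ `(ℂ^m, 0) → (ℂ^m, 0)`. -/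
def IsBiholGerm {m : ℕ} (h : (Fin m → ℂ) → (Fin m → ℂ)) : Prop :=
  AnalyticAt ℂ h 0 ∧ h 0 = 0 ∧
    ∃ g : (Fin m → ℂ) → (Fin m → ℂ), AnalyticAt ℂ g 0 ∧ g 0 = 0 ∧
      (∀ᶠ t in 𝓝 0, g (h t) = t) ∧ (∀ᶠ t in 𝓝 0, h (g t) = t)

/-- `T = ∑ T⁽ⁿ⁾ zⁿ` is a formal isomorphism between `N` (with matrices `A_i`, `B`) and `N'`
(with matrices `Ã_i`, `B̃`) which covers `h`. With `T̃ = T ∘ h` the equations are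
`z ∂_i T̃ + ∑_j (∂_i h^j) (A_j ∘ h) T̃ - T̃ Ã_i = 0` and
`z² ∂_z T̃ + (B ∘ h) T̃ - T̃ B̃ = 0`. -/
structure IsFormalIso {m r : ℕ} (N N' : FormalTE m r) (h : (Fin m → ℂ) → (Fin m → ℂ))
    (T : FMat m r) : Prop where
  bihol : IsBiholGerm h
  hol : IsHol T
  invertible : (Matrix.of fun a b => PowerSeries.coeff 0 (T a b) 0).det ≠ 0
  eq_t : ∀ i, GermEq
    (zz m • pd i (pullback T h)
      + ∑ j, (PowerSeries.C (pdFun i fun t => h t j) : FSeries m) •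
          (pullback (N.A j) h * pullback T h)
      - pullback T h * N'.A i) 0
  eq_z : GermEq
    (zz m ^ 2 • dz (pullback T h) + pullback N.B h * pullback T h - pullback T h * N'.B) 0

/-- `N` and `N'` are formally isomorphic. -/
def FormallyIso {m r : ℕ} (N N' : FormalTE m r) : Prop := ∃ h T, IsFormalIso N N' h T

/-- `N` and `N'` are formally gauge isomorphic: there is a formal isomorphism which covers the
identity map. -/
def FormallyGaugeIso {m r : ℕ} (N N' : FormalTE m r) : Prop := ∃ T, IsFormalIso N N' id T

/-! ### The matrices `C₁ = Id`, `C₂`, `D`, `E` -/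

def C₁ : FMat 2 2 := 1
def C₂ : FMat 2 2 := !![0, 0; 1, 0]
def D : FMat 2 2 := !![1, 0; 0, -1]
def E : FMat 2 2 := !![0, 1; 0, 0]

/-- The variables `z`, `t₁`, `t₂`. -/
def z : FSeries 2 := zz 2
def t₁ : FSeries 2 := tt 0
def t₂ : FSeries 2 := tt 1

/-- The (names of the) formal normal forms, with their constants. In `iii5`, `iii6`, `iii7` the
positive integer `n` is `λ`; in `iii8`, `iii9` the negative integer `λ` is `-n`. -/
inductive NormalForm : Type
  | i (c α c₀ : ℂ)
  | ii (c α : ℂ) (r : ℕ) (hr : 1 ≤ r)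
  | iii1 (c α : ℂ)
  | iii2 (c α : ℂ)
  | iii3 (c α l : ℂ) (hl : ¬ ∃ n : ℤ, n ≠ 0 ∧ l = n)
  | iii4 (c α l : ℂ) (hl : ¬ ∃ n : ℤ, n ≠ 0 ∧ l = n)
  | iii5 (c α γ : ℂ) (n : ℕ) (hn : 1 ≤ n)
  | iii6 (c α : ℂ) (n : ℕ) (hn : 1 ≤ n)
  | iii7 (c α : ℂ) (n : ℕ) (hn : 1 ≤ n)
  | iii8 (c α : ℂ) (n : ℕ) (hn : 1 ≤ n)
  | iii9 (c α : ℂ) (n : ℕ) (hn : 1 ≤ n)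

namespace NormalForm

/-- The matrix `A₂` of a formal normal form (the matrix `A₁` is always `C₁`). -/
def A₂ : NormalForm → FMat 2 2
  | i _ _ _ => C₂ + z • E
  | ii _ _ r _ => C₂ + (z * t₂ ^ r) • E
  | _ => C₂

/-- The matrix `B` of a formal normal form. -/
def B : NormalForm → FMat 2 2
  | i c α c₀ =>
      (-t₁ + kk c + kk α * z) • C₁ + (-(kk (1 / 2) * t₂) + kk c₀) • C₂
        - (kk (1 / 4) * z) • D + (z * (-(kk (1 / 2) * t₂) + kk c₀)) • E
  | ii c α r _ =>
      (-t₁ + kk c + kk α * z) • C₁ - (kk (1 / (r + 2)) * t₂) • C₂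
        - (kk ((r + 1) / (2 * (r + 2))) * z) • D - (kk (1 / (r + 2)) * z * t₂ ^ (r + 1)) • E
  | iii1 c α =>
      (-t₁ + kk c + kk α * z) • C₁ - (kk (1 / 2) * z) • D
  | iii2 c α =>
      (-t₁ + kk c + kk α * z) • C₁ + t₂ ^ 2 • C₂ - (z * (t₂ + kk (1 / 2))) • D - z ^ 2 • E
  | iii3 c α l _ =>
      (-t₁ + kk c + kk α * z) • C₁ + (kk l * t₂) • C₂ - (kk (1 / 2) * z * (kk l + 1)) • D
  | iii4 c α l _ =>
      (-t₁ + kk c + kk α * z) • C₁ + (kk l * t₂ + 1) • C₂ - (kk (1 / 2) * z * (kk l + 1)) • D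
  | iii5 c α γ n _ =>
      (-t₁ + kk c + kk α * z) • C₁ + (kk n * t₂ + 1 + kk γ * t₂ ^ 2 * z ^ n) • C₂
        - (kk (1 / 2) * z * (kk n + 1 + 2 * kk γ * t₂ * z ^ n)) • D
        - (kk γ * z ^ (n + 2)) • E
  | iii6 c α n _ =>
      (-t₁ + kk c + kk α * z) • C₁ + (t₂ * (kk n + t₂ * z ^ n)) • C₂
        - (kk (1 / 2) * z * (kk n + 1 + 2 * t₂ * z ^ n)) • D - z ^ (n + 2) • E
  | iii7 c α n _ =>
      (-t₁ + kk c + kk α * z) • C₁ + (t₂ * kk n) • C₂ - (kk (1 / 2) * z * (kk n + 1)) • D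
  | iii8 c α n _ =>
      (-t₁ + kk c + kk α * z) • C₁ + (kk (-n) * t₂ + z ^ n) • C₂
        - (kk (1 / 2) * z * (kk (-n) + 1)) • D
  | iii9 c α n _ =>
      (-t₁ + kk c + kk α * z) • C₁ + (kk (-n) * t₂) • C₂
        - (kk (1 / 2) * z * (kk (-n) + 1)) • D

end NormalForm

/-! ### The formal normal forms are formal `(TE)`-structures -/

/-- All coefficients are entire functions of `t`. -/
def Entire {m : ℕ} (f : FSeries m) : Prop :=
  ∀ n, AnalyticOnNhd ℂ (PowerSeries.coeff n f) Set.univ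

theorem Entire.add {m : ℕ} {f g : FSeries m} (hf : Entire f) (hg : Entire g) :
    Entire (f + g) := fun n => by
  rw [map_add]; exact (hf n).add (hg n)

theorem Entire.neg {m : ℕ} {f : FSeries m} (hf : Entire f) : Entire (-f) := fun n => by
  rw [map_neg]; exact (hf n).neg

theorem Entire.sub {m : ℕ} {f g : FSeries m} (hf : Entire f) (hg : Entire g) :
    Entire (f - g) := by
  rw [sub_eq_add_neg]; exact hf.add hg.neg

theorem Entire.mul {m : ℕ} {f g : FSeries m} (hf : Entire f) (hg : Entire g) :
    Entire (f * g) := fun n => by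
  rw [PowerSeries.coeff_mul]
  exact Finset.analyticOnNhd_sum _ fun p _ => (hf p.1).mul (hg p.2)

theorem entire_C {m : ℕ} {f : (Fin m → ℂ) → ℂ} (hf : AnalyticOnNhd ℂ f Set.univ) :
    Entire (PowerSeries.C f : FSeries m) := fun n => by
  rw [PowerSeries.coeff_C]
  split_ifs
  · exact hf
  · exact analyticOnNhd_const

theorem entire_kk {m : ℕ} (c : ℂ) : Entire (kk c : FSeries m) :=
  entire_C analyticOnNhd_const

theorem entire_zero {m : ℕ} : Entire (0 : FSeries m) := by
  intro n; rw [map_zero]; exact analyticOnNhd_const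

theorem entire_one {m : ℕ} : Entire (1 : FSeries m) := entire_kk 1

theorem entire_two {m : ℕ} : Entire (2 : FSeries m) := by
  rw [← one_add_one_eq_two]; exact entire_one.add entire_one

theorem entire_tt {m : ℕ} (i : Fin m) : Entire (tt i : FSeries m) :=
  entire_C fun x _ => (ContinuousLinearMap.proj (R := ℂ) (φ := fun _ : Fin m => ℂ) i).analyticAt x

theorem entire_zz {m : ℕ} : Entire (zz m) := fun n => by
  rw [zz, PowerSeries.coeff_X]
  split_ifs
  · exact analyticOnNhd_const
  · exact analyticOnNhd_const

theorem Entire.pow {m : ℕ} {f : FSeries m} (hf : Entire f) (n : ℕ) : Entire (f ^ n) := by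
  induction n with
  | zero => rw [pow_zero]; exact entire_one
  | succ n ih => rw [pow_succ]; exact ih.mul hf

theorem Entire.diffAt {m : ℕ} {f : FSeries m} (hf : Entire f) (n : ℕ) (t : Fin m → ℂ) :
    DifferentiableAt ℂ (PowerSeries.coeff n f) t := (hf n t trivial).differentiableAt

/-- `f` is entire in `t` and `∂_i f = f'`. -/
def HasPd {m : ℕ} (i : Fin m) (f f' : FSeries m) : Prop := Entire f ∧ pdSeries i f = f'

section HasPd

variable {m : ℕ} {i : Fin m} {f g f' g' : FSeries m}

theorem HasPd.add (hf : HasPd i f f') (hg : HasPd i g g') : HasPd i (f + g) (f' + g') := by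
  refine ⟨hf.1.add hg.1, ?_⟩
  rw [← hf.2, ← hg.2]
  ext n t
  simp only [pdSeries, PowerSeries.coeff_mk, map_add, pdFun, Pi.add_apply]
  rw [fderiv_add (hf.1.diffAt n t) (hg.1.diffAt n t)]
  rfl

theorem HasPd.neg (hf : HasPd i f f') : HasPd i (-f) (-f') := by
  refine ⟨hf.1.neg, ?_⟩
  rw [← hf.2]
  ext n t
  simp only [pdSeries, PowerSeries.coeff_mk, map_neg, pdFun, Pi.neg_apply]
  rw [fderiv_neg]
  rfl

theorem HasPd.sub (hf : HasPd i f f') (hg : HasPd i g g') : HasPd i (f - g) (f' - g') := by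
  rw [sub_eq_add_neg, sub_eq_add_neg]; exact hf.add hg.neg

theorem HasPd.mul (hf : HasPd i f f') (hg : HasPd i g g') :
    HasPd i (f * g) (f' * g + f * g') := by
  refine ⟨hf.1.mul hg.1, ?_⟩
  rw [← hf.2, ← hg.2]
  ext n t
  simp only [pdSeries, PowerSeries.coeff_mk, map_add, Pi.add_apply, PowerSeries.coeff_mul, pdFun]
  rw [fderiv_sum fun p _ => (hf.1.diffAt p.1 t).mul (hg.1.diffAt p.2 t)]
  simp only [Finset.sum_apply, sum_apply, Pi.mul_apply]
  rw [← Finset.sum_add_distrib]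
  refine Finset.sum_congr rfl fun p _ => ?_
  rw [fderiv_mul (hf.1.diffAt p.1 t) (hg.1.diffAt p.2 t)]
  simp only [add_apply, smul_apply, smul_eq_mul, pdFun]
  ring

theorem hasPd_kk (c : ℂ) : HasPd i (kk c) 0 := by
  refine ⟨entire_kk c, ?_⟩
  ext n t
  simp only [pdSeries, PowerSeries.coeff_mk, kk, PowerSeries.coeff_C, pdFun, map_zero,
    Pi.zero_apply]
  split_ifs
  · simp
  · change (fderiv ℂ (fun _ => (0 : ℂ)) t) _ = 0
    simp

theorem hasPd_zero : HasPd i (0 : FSeries m) 0 := by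
  have h := hasPd_kk (i := i) (m := m) 0
  have h0 : (kk 0 : FSeries m) = 0 := map_zero PowerSeries.C
  rwa [h0] at h

theorem hasPd_one : HasPd i (1 : FSeries m) 0 := hasPd_kk 1

theorem hasPd_two : HasPd i (2 : FSeries m) 0 := by
  have h := (hasPd_one (i := i) (m := m)).add hasPd_one
  rwa [one_add_one_eq_two, add_zero] at h

theorem hasPd_zz : HasPd i (zz m) 0 := by
  refine ⟨entire_zz, ?_⟩
  ext n t
  simp only [pdSeries, PowerSeries.coeff_mk, zz, PowerSeries.coeff_X, pdFun, map_zero,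
    Pi.zero_apply]
  split_ifs
  · change (fderiv ℂ (fun _ => (1 : ℂ)) t) _ = 0
    simp
  · change (fderiv ℂ (fun _ => (0 : ℂ)) t) _ = 0
    simp

theorem hasPd_tt (j : Fin m) : HasPd i (tt j) (kk (if j = i then 1 else 0)) := by
  refine ⟨entire_tt j, ?_⟩
  ext n t
  simp only [pdSeries, PowerSeries.coeff_mk, tt, kk, PowerSeries.coeff_C, pdFun]
  by_cases hn : n = 0
  · simp only [hn, if_true]
    have := (ContinuousLinearMap.proj (R := ℂ) (φ := fun _ : Fin m => ℂ) j).hasFDerivAt (x := t)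
    have h2 : fderiv ℂ (fun t : Fin m → ℂ => t j) t
        = ContinuousLinearMap.proj (R := ℂ) (φ := fun _ : Fin m => ℂ) j := this.fderiv
    rw [h2]
    simp [Pi.single_apply]
  · simp only [hn, if_false]
    change (fderiv ℂ (fun _ => (0 : ℂ)) t) _ = 0
    simp

theorem HasPd.pow (hf : HasPd i f f') (n : ℕ) :
    HasPd i (f ^ n) ((n : FSeries m) * f ^ (n - 1) * f') := by
  induction n with
  | zero => simpa using hasPd_one
  | succ n ih =>
    rw [pow_succ]
    have := ih.mul hf
    convert this using 1
    cases n with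
    | zero => simp
    | succ n =>
      simp only [Nat.add_sub_cancel]
      push_cast
      ring

theorem HasPd.congr (hf : HasPd i f f') (h : f' = g') : HasPd i f g' := h ▸ hf

end HasPd

theorem GermEq.of_eq {m r : ℕ} {F G : FMat m r} (h : F = G) : GermEq F G := by
  subst h
  intro a b n
  exact Filter.EventuallyEq.rfl

theorem IsHol.of_entire {m r : ℕ} {F : FMat m r} (h : ∀ a b, Entire (F a b)) : IsHol F :=
  ⟨Set.univ, Filter.univ_mem, fun a b n => h a b n⟩

/-- Formal `(TE)`-structures with `A₁ = C₁`, `A₂ = C₂ + z f E` and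
`B = (-t₁ + c + α z) C₁ + b₂ C₂ + z b₃ D + z b₄ E`. -/
theorem flat_of_eqs {f b₂ b₃ b₄ b₂' b₃' b₄' : FSeries 2} {c α : ℂ} {A B : FMat 2 2}
    (hA : A = C₂ + (z * f) • E)
    (hB : B = (-t₁ + kk c + kk α * z) • C₁ + b₂ • C₂ + (z * b₃) • D + (z * b₄) • E)
    (hf : HasPd 0 f 0) (hfz : PowerSeries.derivative _ f = 0)
    (h₂ : HasPd 0 b₂ 0) (h₃ : HasPd 0 b₃ 0) (h₄ : HasPd 0 b₄ 0)
    (h₂' : HasPd 1 b₂ b₂') (h₃' : HasPd 1 b₃ b₃') (h₄' : HasPd 1 b₄ b₄')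
    (e₁ : b₂' + 2 * b₃ + 1 = 0) (e₂ : z * b₃' - b₄ + f * b₂ = 0)
    (e₃ : b₄' - 2 * f * b₃ = 0) :
    IsHol A ∧ IsHol B ∧
    (∀ i j, GermEq (zz 2 • pd i (![C₁, A] j) - zz 2 • pd j (![C₁, A] i)
      + (![C₁, A] i * ![C₁, A] j - ![C₁, A] j * ![C₁, A] i)) 0) ∧
    (∀ i, GermEq (zz 2 • pd i B - zz 2 ^ 2 • dz (![C₁, A] i) + zz 2 • ![C₁, A] i
      + (![C₁, A] i * B - B * ![C₁, A] i)) 0) := by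
  have hk0 : (kk 0 : FSeries 2) = 0 := map_zero PowerSeries.C
  have hk1 : (kk 1 : FSeries 2) = 1 := map_one PowerSeries.C
  have hz : ∀ i, HasPd i z 0 := fun i => hasPd_zz
  have ht0 : HasPd 0 t₁ 1 := (hasPd_tt 0).congr (by simpa using hk1)
  have ht1 : HasPd 1 t₁ 0 := (hasPd_tt 0).congr (by simpa using hk0)
  have hA' : A = !![0, z * f; 1, 0] := by
    rw [hA]; refine Matrix.ext fun a b => ?_; fin_cases a <;> fin_cases b <;> simp [C₂, E]
  have hB' : B = !![-t₁ + kk c + kk α * z + z * b₃, z * b₄; b₂,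
      -t₁ + kk c + kk α * z - z * b₃] := by
    rw [hB]; refine Matrix.ext fun a b => ?_; fin_cases a <;> fin_cases b <;> simp [C₁, C₂, D, E] <;> ring
  have h1 : C₁ = !![1, 0; 0, 1] := by
    refine Matrix.ext fun a b => ?_; fin_cases a <;> fin_cases b <;> simp [C₁]
  have p0 : ∀ i : Fin 2, pd i C₁ = 0 := fun i => by
    rw [h1]
    refine Matrix.ext fun a b => ?_
    fin_cases a <;> fin_cases b
    · exact hasPd_one.2
    · exact hasPd_zero.2
    · exact hasPd_zero.2
    · exact hasPd_one.2
  have pA : pd 0 A = 0 := by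
    rw [hA']
    refine Matrix.ext fun a b => ?_
    fin_cases a <;> fin_cases b
    · exact hasPd_zero.2
    · exact (((hz 0).mul hf).congr (by ring : _ = (0 : FSeries 2))).2
    · exact hasPd_one.2
    · exact hasPd_zero.2
  have s0 : HasPd 0 (-t₁ + kk c + kk α * z) (-1) :=
    ((ht0.neg.add (hasPd_kk c)).add ((hasPd_kk α).mul (hz 0))).congr (by ring)
  have s1 : HasPd 1 (-t₁ + kk c + kk α * z) 0 :=
    ((ht1.neg.add (hasPd_kk c)).add ((hasPd_kk α).mul (hz 1))).congr (by ring)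
  have B0 : pd 0 B = !![-1, 0; 0, -1] := by
    rw [hB']
    refine Matrix.ext fun a b => ?_
    fin_cases a <;> fin_cases b
    · exact ((s0.add ((hz 0).mul h₃)).congr (by ring : _ = (-1 : FSeries 2))).2
    · exact (((hz 0).mul h₄).congr (by ring : _ = (0 : FSeries 2))).2
    · exact h₂.2
    · exact ((s0.sub ((hz 0).mul h₃)).congr (by ring : _ = (-1 : FSeries 2))).2
  have B1 : pd 1 B = !![z * b₃', z * b₄'; b₂', - (z * b₃')] := by
    rw [hB']
    refine Matrix.ext fun a b => ?_
    fin_cases a <;> fin_cases b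
    · exact ((s1.add ((hz 1).mul h₃')).congr (by ring : _ = z * b₃')).2
    · exact (((hz 1).mul h₄').congr (by ring : _ = z * b₄')).2
    · exact h₂'.2
    · exact ((s1.sub ((hz 1).mul h₃')).congr (by ring : _ = -(z * b₃'))).2
  have dz1 : dz C₁ = 0 := by
    rw [h1]; refine Matrix.ext fun a b => ?_; fin_cases a <;> fin_cases b <;> simp [dz]
  have dzA : dz A = !![0, f; 0, 0] := by
    rw [hA']; refine Matrix.ext fun a b => ?_
    fin_cases a <;> fin_cases b <;> simp [dz, z, zz, hfz, Derivation.leibniz]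
  refine ⟨?_, ?_, ?_, ?_⟩
  · rw [hA']
    refine IsHol.of_entire fun a b => ?_
    fin_cases a <;> fin_cases b
    · exact entire_zero
    · exact ((hz 0).mul hf).1
    · exact entire_one
    · exact entire_zero
  · rw [hB']
    refine IsHol.of_entire fun a b => ?_
    fin_cases a <;> fin_cases b
    · exact (s0.add ((hz 0).mul h₃)).1
    · exact ((hz 0).mul h₄).1
    · exact h₂.1
    · exact (s0.sub ((hz 0).mul h₃)).1
  · intro i j
    refine GermEq.of_eq ?_
    fin_cases i <;> fin_cases j <;> simp [p0, pA] <;> simp [C₁]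
  · intro i
    refine GermEq.of_eq ?_
    fin_cases i
    · simp only [Fin.zero_eta, Matrix.cons_val_zero, B0, dz1]
      have : B = C₁ * B := (one_mul B).symm
      rw [show C₁ * B - B * C₁ = 0 by simp [C₁], h1]
      refine Matrix.ext fun a b => ?_
      fin_cases a <;> fin_cases b <;> simp
    · simp only [Fin.mk_one, Matrix.cons_val_one, Matrix.cons_val_fin_one, B1, dzA]
      rw [hA', hB', show zz 2 = z from rfl]
      refine Matrix.ext fun a b => ?_
      fin_cases a <;> fin_cases b <;> simp
      · linear_combination z * e₂
      · linear_combination z ^ 2 * e₃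
      · linear_combination z * e₁
      · linear_combination -z * e₂

theorem kk_half : (2 : FSeries 2) * kk (1 / 2) = 1 := by
  have h2 : (2 : FSeries 2) = kk 2 := (map_ofNat PowerSeries.C 2).symm
  rw [h2, kk, kk, ← map_mul]
  refine Eq.trans (congrArg _ ?_) (map_one PowerSeries.C)
  funext t
  simp

namespace NormalForm

theorem flat (P : NormalForm) :
    IsHol P.A₂ ∧ IsHol P.B ∧
    (∀ i j, GermEq (zz 2 • pd i (![C₁, P.A₂] j) - zz 2 • pd j (![C₁, P.A₂] i)
      + (![C₁, P.A₂] i * ![C₁, P.A₂] j - ![C₁, P.A₂] j * ![C₁, P.A₂] i)) 0) ∧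
    (∀ i, GermEq (zz 2 • pd i P.B - zz 2 ^ 2 • dz (![C₁, P.A₂] i) + zz 2 • ![C₁, P.A₂] i
      + (![C₁, P.A₂] i * P.B - P.B * ![C₁, P.A₂] i)) 0) := by
  have hk0 : (kk 0 : FSeries 2) = 0 := map_zero PowerSeries.C
  have hk1 : (kk 1 : FSeries 2) = 1 := map_one PowerSeries.C
  have hz : ∀ i, HasPd i z 0 := fun i => hasPd_zz
  have h0 : HasPd 0 t₂ 0 := (hasPd_tt 1).congr (by simpa using hk0)
  have h1 : HasPd 1 t₂ 1 := (hasPd_tt 1).congr (by simpa using hk1)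
  have hh := kk_half
  -- the cases with `f = 0` and `b₂ = u + v t₂ + w t₂²`, where `u`, `v`, `w` depend on `z` only
  have key : ∀ (c α : ℂ) (A B : FMat 2 2) (u v w : FSeries 2), A = C₂ →
      (∀ i, HasPd i u 0) → (∀ i, HasPd i v 0) → (∀ i, HasPd i w 0) →
      B = (-t₁ + kk c + kk α * z) • C₁ + (u + v * t₂ + w * t₂ ^ 2) • C₂
        + (z * (-(kk (1 / 2) * (v + 1)) - w * t₂)) • D + (z * (-(z * w))) • E → _ :=
    fun c α A B u v w hA hu hv hw hB =>
      flat_of_eqs (f := 0) (A := A) (B := B) (by rw [hA]; simp) hB hasPd_zero (map_zero _)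
        ((((hu 0).add ((hv 0).mul h0)).add ((hw 0).mul (h0.pow 2))).congr (by ring))
        (((((hasPd_kk _).mul ((hv 0).add hasPd_one)).neg).sub ((hw 0).mul h0)).congr (by ring))
        ((((hz 0).mul (hw 0)).neg).congr (by ring))
        (((hu 1).add ((hv 1).mul h1)).add ((hw 1).mul (h1.pow 2)))
        ((((hasPd_kk _).mul ((hv 1).add hasPd_one)).neg).sub ((hw 1).mul h1))
        (((hz 1).mul (hw 1)).neg)
        (by simp only [Nat.cast_ofNat, Nat.add_one_sub_one, pow_one]; linear_combination -(v + 1) * hh) (by ring) (by ring)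
  have hzn : ∀ (n : ℕ) (i), HasPd i (z ^ n) 0 := fun n i => ((hz i).pow n).congr (by ring)
  cases P with
  | i c α c₀ =>
    have hq : (2 : FSeries 2) * kk (1 / 4) = kk (1 / 2) := by
      have h2 : (2 : FSeries 2) = kk 2 := (map_ofNat PowerSeries.C 2).symm
      rw [h2, kk, kk, kk, ← map_mul]
      refine congrArg _ ?_
      funext t
      simp; norm_num
    refine flat_of_eqs (f := 1) (b₂ := -(kk (1 / 2) * t₂) + kk c₀) (b₃ := -kk (1 / 4))
      (b₄ := -(kk (1 / 2) * t₂) + kk c₀) (c := c) (α := α)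
      (by simp [A₂]) ?_ hasPd_one (by simp)
      (((((hasPd_kk _).mul h0).neg).add (hasPd_kk _)).congr (by ring))
      ((hasPd_kk _).neg.congr (by ring))
      (((((hasPd_kk _).mul h0).neg).add (hasPd_kk _)).congr (by ring))
      ((((hasPd_kk _).mul h1).neg).add (hasPd_kk _))
      (hasPd_kk _).neg
      ((((hasPd_kk _).mul h1).neg).add (hasPd_kk _)) ?_ ?_ ?_
    · simp only [B]
      refine Matrix.ext fun a b => ?_
      fin_cases a <;> fin_cases b <;> simp [C₁, C₂, D, E] <;> ring
    · linear_combination -hq - hh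
    · ring
    · linear_combination hq
  | ii c α r hr =>
    have hq : (2 : FSeries 2) * kk ((r + 1) / (2 * (r + 2))) + kk (1 / (r + 2)) = 1 := by
      have h2 : (2 : FSeries 2) = kk 2 := (map_ofNat PowerSeries.C 2).symm
      rw [h2, kk, kk, kk, ← map_mul, ← map_add]
      refine Eq.trans (congrArg _ ?_) (map_one PowerSeries.C)
      funext t
      have : (r : ℂ) + 2 ≠ 0 := by exact_mod_cast (by omega : r + 2 ≠ 0)
      simp
      field_simp
      ring
    have hq2 : ((r : FSeries 2) + 1) * kk (1 / (r + 2)) = 2 * kk ((r + 1) / (2 * (r + 2))) := by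
      have h2 : (2 : FSeries 2) = kk 2 := (map_ofNat PowerSeries.C 2).symm
      have hr' : (r : FSeries 2) = kk r := (map_natCast PowerSeries.C r).symm
      rw [h2, hr', ← hk1, kk, kk, kk, kk, kk, ← map_mul, ← map_add, ← map_mul]
      refine congrArg _ ?_
      funext t
      have : (r : ℂ) + 2 ≠ 0 := by exact_mod_cast (by omega : r + 2 ≠ 0)
      simp
      field_simp
    refine flat_of_eqs (f := t₂ ^ r) (b₂ := -(kk (1 / (r + 2)) * t₂))
      (b₃ := -kk ((r + 1) / (2 * (r + 2))))
      (b₄ := -(kk (1 / (r + 2)) * t₂ ^ (r + 1))) (c := c) (α := α)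
      (by simp [A₂]) ?_ ((h0.pow r).congr (by ring)) ?_
      ((((hasPd_kk _).mul h0).neg).congr (by ring))
      ((hasPd_kk _).neg.congr (by ring))
      ((((hasPd_kk _).mul (h0.pow _)).neg).congr (by ring))
      (((hasPd_kk _).mul h1).neg)
      (hasPd_kk _).neg
      (((hasPd_kk _).mul (h1.pow _)).neg) ?_ ?_ ?_
    · simp only [B]
      refine Matrix.ext fun a b => ?_
      fin_cases a <;> fin_cases b <;> simp [C₁, C₂, D, E] <;> ring
    · simp [t₂, tt, Derivation.leibniz_pow]
    · linear_combination -hq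
    · ring
    · simp only [Nat.add_sub_cancel]
      push_cast
      linear_combination -t₂ ^ r * hq2
  | iii1 c α =>
    refine key c α _ _ 0 0 0 rfl (fun _ => hasPd_zero) (fun _ => hasPd_zero)
      (fun _ => hasPd_zero) ?_
    simp only [B]
    refine Matrix.ext fun a b => ?_
    fin_cases a <;> fin_cases b <;> simp [C₁, C₂, D, E] <;> ring
  | iii2 c α =>
    refine key c α _ _ 0 0 1 rfl (fun _ => hasPd_zero) (fun _ => hasPd_zero)
      (fun _ => hasPd_one) ?_
    simp only [B]
    refine Matrix.ext fun a b => ?_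
    fin_cases a <;> fin_cases b <;> simp [C₁, C₂, D, E] <;> ring
  | iii3 c α l hl =>
    refine key c α _ _ 0 (kk l) 0 rfl (fun _ => hasPd_zero) (fun _ => hasPd_kk _)
      (fun _ => hasPd_zero) ?_
    simp only [B]
    refine Matrix.ext fun a b => ?_
    fin_cases a <;> fin_cases b <;> simp [C₁, C₂, D, E] <;> ring
  | iii4 c α l hl =>
    refine key c α _ _ 1 (kk l) 0 rfl (fun _ => hasPd_one) (fun _ => hasPd_kk _)
      (fun _ => hasPd_zero) ?_
    simp only [B]
    refine Matrix.ext fun a b => ?_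
    fin_cases a <;> fin_cases b <;> simp [C₁, C₂, D, E] <;> ring
  | iii5 c α γ n hn =>
    refine key c α _ _ 1 (kk n) (kk γ * z ^ n) rfl (fun _ => hasPd_one) (fun _ => hasPd_kk _)
      (fun i => ((hasPd_kk _).mul (hzn n i)).congr (by ring)) ?_
    simp only [B]
    rw [show kk (1 / 2) * z * (kk n + 1 + 2 * kk γ * t₂ * z ^ n) =
      kk (1 / 2) * z * (kk n + 1) + z * kk γ * t₂ * z ^ n by
        linear_combination z * kk γ * t₂ * z ^ n * hh]
    refine Matrix.ext fun a b => ?_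
    fin_cases a <;> fin_cases b <;> simp [C₁, C₂, D, E] <;> ring
  | iii6 c α n hn =>
    refine key c α _ _ 0 (kk n) (z ^ n) rfl (fun _ => hasPd_zero) (fun _ => hasPd_kk _)
      (fun i => hzn n i) ?_
    simp only [B]
    rw [show kk (1 / 2) * z * (kk n + 1 + 2 * t₂ * z ^ n) =
      kk (1 / 2) * z * (kk n + 1) + z * t₂ * z ^ n by
        linear_combination z * t₂ * z ^ n * hh]
    refine Matrix.ext fun a b => ?_
    fin_cases a <;> fin_cases b <;> simp [C₁, C₂, D, E] <;> ring
  | iii7 c α n hn =>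
    refine key c α _ _ 0 (kk n) 0 rfl (fun _ => hasPd_zero) (fun _ => hasPd_kk _)
      (fun _ => hasPd_zero) ?_
    simp only [B]
    refine Matrix.ext fun a b => ?_
    fin_cases a <;> fin_cases b <;> simp [C₁, C₂, D, E] <;> ring
  | iii8 c α n hn =>
    refine key c α _ _ (z ^ n) (kk (-n)) 0 rfl (fun i => hzn n i) (fun _ => hasPd_kk _)
      (fun _ => hasPd_zero) ?_
    simp only [B]
    refine Matrix.ext fun a b => ?_
    fin_cases a <;> fin_cases b <;> simp [C₁, C₂, D, E] <;> ring
  | iii9 c α n hn =>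
    refine key c α _ _ 0 (kk (-n)) 0 rfl (fun _ => hasPd_zero) (fun _ => hasPd_kk _)
      (fun _ => hasPd_zero) ?_
    simp only [B]
    refine Matrix.ext fun a b => ?_
    fin_cases a <;> fin_cases b <;> simp [C₁, C₂, D, E] <;> ring

/-- The formal `(TE)`-structure, of rank `2` over `(ℂ², 0)`, given by a formal normal form. -/
def toTE (P : NormalForm) : FormalTE 2 2 where
  A := ![C₁, P.A₂]
  B := P.B
  hol_A i := by
    fin_cases i
    · refine IsHol.of_entire fun a b => ?_
      change Entire ((1 : FMat 2 2) a b)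
      rw [Matrix.one_apply]
      split_ifs
      · exact entire_one
      · exact entire_zero
    · exact P.flat.1
  hol_B := P.flat.2.1
  flat_A := P.flat.2.2.1
  flat_B := P.flat.2.2.2

end NormalForm

end TEStruct

end

noncomputable section

namespace TEStruct

open PowerSeries

/-! Let T cover h, and write a, b, c, d for the entries of T∘h, f, f̃ for the coefficients of zE in
the two matrices A₂, and m = ∂₂h². The proof extracts a few invariants from low-order terms in z,
lets them decide all pairs of normal forms, and writes down the surviving isomorphisms.

In the t₂-equation, order 0 in z says that C₂ is transported to itself. This forces ∂₂h¹ = 0, b =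
O(z) and d = m a modulo z, with a and m invertible (`IsFormalIso.eventually_leading`). Order 1 of
the upper right entry then gives m² (f∘h) = f̃ (`IsFormalIso.quad_eq`), so the vanishing of f is an
invariant and (iii) is separated from (i) and (ii).

In the z-equation it is enough to set t = 0. As h(0) = 0, the map h enters only through the number
m, and an ordinary differential equation in z remains. At t = 0 all normal forms have one shape:
diagonal c + (α ∓ (λ+1)/2) z, lower left entry u, upper right entry z w, where λ is the slope of the
C₂-coefficient at z = 0 (`NormalForm.map_ev_B`). Comparing coefficients
(`IsFormalIso.originRelations`) shows that c and α are invariants, that u₀ = m ũ₀ and m w₀ = w̃₀,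
and that λ is preserved, or preserved up to sign when ũ₀ ≠ 0 and w, w̃ = O(z²). If λ = n or λ = -n
is an integer, the unknown coefficient of b or c cancels at exactly one order; this resonance makes
the coefficient of w at order n+1, respectively of u at order n, invariant up to the factor m.

These relations leave only c₀ ↦ -c₀ in (i), λ ↦ -λ in (iii.4), and the coincidence of (iii.1) with
(iii.3) at λ = 0, which are the same structure. The first two are realised by t₂ ↦ -t₂ and by the
Möbius map t₂ ↦ t₂/(1 - λt₂). A gauge isomorphism has m = 1 identically, hence fixes the whole
C₂-coefficient of B at z = 0, and so cannot change these signs. -/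

/-- Evaluation at `t` of the coefficients of a power series. -/
def ev (t : Fin 2 → ℂ) : FSeries 2 →+* ℂ⟦X⟧ := PowerSeries.map (Pi.evalRingHom (fun _ => ℂ) t)

/-! ### Restricting series and matrix equations to a point of the base -/

section ev

variable (t : Fin 2 → ℂ)

theorem coeff_ev (f : FSeries 2) (n : ℕ) : coeff n (ev t f) = coeff n f t := by
  simp [ev]

theorem ev_C (f : (Fin 2 → ℂ) → ℂ) : ev t (C f) = C (f t) := by simp [ev]

theorem ev_zz : ev t (zz 2) = X := by simp [ev, zz]

theorem ev_z : ev t z = X := ev_zz t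

theorem ev_kk (c : ℂ) : ev t (kk c) = C c := by simp [ev, kk]

theorem ev_t₁ : ev t t₁ = C (t 0) := by simp [ev, t₁, tt]

theorem ev_t₂ : ev t t₂ = C (t 1) := by simp [ev, t₂, tt]

theorem map_ev_zero : (0 : FMat 2 2).map (ev t) = 0 := by ext; simp

theorem map_ev_smul (s : FSeries 2) (F : FMat 2 2) :
    (s • F).map (ev t) = ev t s • F.map (ev t) := by
  ext; simp

theorem map_ev_pullback (F : FMat 2 2) (h : (Fin 2 → ℂ) → (Fin 2 → ℂ)) :
    (pullback F h).map (ev t) = F.map (ev (h t)) := by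
  ext a b n
  simp [coeff_ev, pullback]

theorem map_ev_dz (F : FMat 2 2) :
    (dz F).map (ev t) = (F.map (ev t)).map fun f => PowerSeries.derivative ℂ f := by
  ext a b n
  simp [coeff_ev, dz, coeff_derivative]

end ev

theorem GermEq.map_ev {F G : FMat 2 2} (h : GermEq F G) : F.map (ev 0) = G.map (ev 0) := by
  ext a b n
  simpa [coeff_ev] using (h a b n).eq_of_nhds

/-- Reduces the check of an explicit isomorphism to matrix identities over ℂ⟦X⟧ at each nearby
point. -/
theorem GermEq.of_eventually {F G : FMat 2 2}
    (h : ∀ᶠ t in 𝓝 (0 : Fin 2 → ℂ), F.map (ev t) = G.map (ev t)) : GermEq F G := by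
  intro a b n
  filter_upwards [h] with t ht
  have := congr_arg (coeff n) (congr_fun₂ ht a b)
  simpa only [Matrix.map_apply, coeff_ev] using this

/-- The `z`-equation of an isomorphism, restricted to the origin. -/
theorem IsFormalIso.eq_z_zero {N N' : FormalTE 2 2} {h T} (H : IsFormalIso N N' h T) :
    (X ^ 2 : ℂ⟦X⟧) • ((T.map (ev 0)).map fun f => PowerSeries.derivative ℂ f)
      + N.B.map (ev 0) * T.map (ev 0) = T.map (ev 0) * N'.B.map (ev 0) := by
  have h0 := H.bihol.2.1
  have h1 := H.eq_z.map_ev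
  rw [Matrix.map_sub _ (map_sub _), Matrix.map_add _ (map_add _), Matrix.map_mul,
    Matrix.map_mul, map_ev_smul, map_ev_dz, map_ev_pullback, map_ev_pullback, h0, map_pow, ev_zz,
    map_ev_zero, sub_eq_zero] at h1
  exact h1

/-! ### The common shape of B at the origin -/

namespace NormalForm

/-- The constant `c`. -/
def cst : NormalForm → ℂ
  | i c _ _ | ii c _ _ _ | iii1 c _ | iii2 c _ | iii3 c _ _ _ | iii4 c _ _ _ | iii5 c _ _ _ _
  | iii6 c _ _ _ | iii7 c _ _ _ | iii8 c _ _ _ | iii9 c _ _ _ => c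

/-- The constant `α`. -/
def alpha : NormalForm → ℂ
  | i _ α _ | ii _ α _ _ | iii1 _ α | iii2 _ α | iii3 _ α _ _ | iii4 _ α _ _ | iii5 _ α _ _ _
  | iii6 _ α _ _ | iii7 _ α _ _ | iii8 _ α _ _ | iii9 _ α _ _ => α

/-- The linear coefficient `λ` of the coefficient of `C₂` in `B`, at `z = 0`. -/
def slope : NormalForm → ℂ
  | i _ _ _ => -(1 / 2)
  | ii _ _ r _ => -(1 / (r + 2))
  | iii1 _ _ | iii2 _ _ => 0
  | iii3 _ _ l _ | iii4 _ _ l _ => l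
  | iii5 _ _ _ n _ | iii6 _ _ n _ | iii7 _ _ n _ => n
  | iii8 _ _ n _ | iii9 _ _ n _ => -n

/-- The coefficient of `C₂` in `B` at the origin. -/
def lower : NormalForm → ℂ⟦X⟧
  | i _ _ c₀ => C c₀
  | iii4 _ _ _ _ | iii5 _ _ _ _ _ => 1
  | iii8 _ _ n _ => X ^ n
  | _ => 0

/-- The coefficient of `z E` in `B` at the origin. -/
def upper : NormalForm → ℂ⟦X⟧
  | i _ _ c₀ => C c₀
  | iii2 _ _ => -X
  | iii5 _ _ γ n _ => -(C γ * X ^ (n + 1))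
  | iii6 _ _ n _ => -X ^ (n + 1)
  | _ => 0

/-- The slope also determines the D-coefficient: flatness in t₂ says b₂' + 2b₃ + 1 = 0, so b₃ =
-(λ+1)/2 at the origin. One formula thus treats all the normal forms at once. -/
theorem map_ev_B (P : NormalForm) :
    P.B.map (ev 0) = !![C P.cst + C (P.alpha - (P.slope + 1) / 2) * X, X * P.upper;
      P.lower, C P.cst + C (P.alpha + (P.slope + 1) / 2) * X] := by
  have hq : (C (1 / 4) : ℂ⟦X⟧) = C (1 / 2) ^ 2 := by rw [← map_pow]; norm_num
  have hd : (C (1 / 2) : ℂ⟦X⟧) = 2 * C (1 / 4) := by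
    rw [← map_ofNat C 2, ← map_mul]; norm_num
  have hr : ∀ r : ℕ, (r : ℂ⟦X⟧) * C ((2 + r : ℂ)⁻¹) + 2 * C ((2 + r : ℂ)⁻¹) = 1 := fun r => by
    have : (2 : ℂ) + r ≠ 0 := by exact_mod_cast (by omega : 2 + r ≠ 0)
    rw [← map_natCast C r, ← map_ofNat C 2, ← map_mul, ← map_mul, ← map_add, ← map_one C]
    congr 1
    field_simp
    ring
  cases P <;> refine Matrix.ext fun a b => ?_ <;> fin_cases a <;> fin_cases b <;>
    simp [B, C₁, C₂, D, E, cst, alpha, slope, lower, upper, ev_z, ev_kk, ev_t₁, ev_t₂,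
      div_eq_mul_inv]
  all_goals first
    | ring1
    | (ring_nf; linear_combination X * hq + X * hd)
    | (ring_nf; linear_combination -X * hq - X * hd)
    | (rename_i r _; ring_nf; linear_combination -X * C (1 / 2) * hr r)
    | (rename_i r _; ring_nf; linear_combination X * C (1 / 2) * hr r)

end NormalForm

/-! ### The t₂-equation: leading terms of T and the invariant of A₂ -/

namespace NormalForm

/-- The coefficient of `z E` in `A₂`. -/
def quad : NormalForm → (Fin 2 → ℂ) → ℂ
  | i _ _ _ => 1
  | ii _ _ r _ => fun t => t 1 ^ r
  | _ => 0

theorem A₂_eq (P : NormalForm) : P.A₂ = !![0, z * C P.quad; 1, 0] := by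
  have : ∀ r : ℕ, t₂ ^ r = C fun t : Fin 2 → ℂ => t 1 ^ r := fun r => by
    rw [t₂, tt, ← map_pow]; rfl
  cases P <;> refine Matrix.ext fun a b => ?_ <;> fin_cases a <;> fin_cases b <;>
    simp [A₂, C₂, E, quad, this]

theorem pullback_A₂ (P : NormalForm) (h : (Fin 2 → ℂ) → (Fin 2 → ℂ)) :
    pullback P.A₂ h = !![0, z * C (P.quad ∘ h); 1, 0] := by
  rw [A₂_eq]
  refine Matrix.ext fun a b => PowerSeries.ext fun n => funext fun t => ?_
  fin_cases a <;> fin_cases b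
  · simp [pullback]
  · by_cases hn : n = 1 <;> simp [pullback, z, zz, coeff_X, hn]
  · by_cases hn : n = 0 <;> simp [pullback, coeff_one, hn]
  · simp [pullback]

theorem pullback_C₁ (h : (Fin 2 → ℂ) → (Fin 2 → ℂ)) : pullback C₁ h = 1 := by
  refine Matrix.ext fun a b => PowerSeries.ext fun n => funext fun t => ?_
  fin_cases a <;> fin_cases b <;> by_cases hn : n = 0 <;>
    simp [pullback, C₁, coeff_one, hn]

end NormalForm

section

variable {P Q : NormalForm} {h : (Fin 2 → ℂ) → (Fin 2 → ℂ)} {T : FMat 2 2}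

theorem IsFormalIso.eq_t₂ (H : IsFormalIso P.toTE Q.toTE h T) :
    GermEq (z • pd 1 (pullback T h) + (C (pdFun 1 fun t => h t 0) : FSeries 2) • pullback T h
      + (C (pdFun 1 fun t => h t 1) : FSeries 2) •
        (!![0, z * C (P.quad ∘ h); 1, 0] * pullback T h)
      - pullback T h * !![0, z * C Q.quad; 1, 0]) 0 := by
  have := H.eq_t 1
  simp only [Fin.sum_univ_two, NormalForm.toTE, Matrix.cons_val_zero, Matrix.cons_val_one,
    NormalForm.pullback_A₂, NormalForm.pullback_C₁, one_mul, NormalForm.A₂_eq Q] at this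
  rwa [← add_assoc] at this

/-- Order 0 in z of the t₂-equation is p T⁽⁰⁾ + m C₂ T⁽⁰⁾ = T⁽⁰⁾ C₂ with T⁽⁰⁾ pulled back by h,
which is linear algebra at each point where the determinant is nonzero. The result is needed on a
neighbourhood, not just at the origin, because it is differentiated later. -/
theorem IsFormalIso.eventually_leading (H : IsFormalIso P.toTE Q.toTE h T) :
    ∀ᶠ t in 𝓝 (0 : Fin 2 → ℂ), pdFun 1 (fun t => h t 0) t = 0 ∧
      coeff 0 (pullback T h 0 1) t = 0 ∧ coeff 0 (pullback T h 0 0) t ≠ 0 ∧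
      pdFun 1 (fun t => h t 1) t ≠ 0 ∧
      coeff 0 (pullback T h 1 1) t
        = pdFun 1 (fun t => h t 1) t * coeff 0 (pullback T h 0 0) t := by
  have e := H.eq_t₂
  obtain ⟨hh, h0, -⟩ := H.bihol
  have hc : ∀ a b, ContinuousAt (fun t => coeff 0 (pullback T h a b) t) 0 := by
    intro a b
    obtain ⟨U, hU, hT⟩ := H.hol
    have : ContinuousAt (coeff 0 (T a b)) (h 0) := by
      rw [h0]; exact (hT a b 0 0 (mem_of_mem_nhds hU)).continuousAt
    have h2 : (fun t => coeff 0 (pullback T h a b) t) = coeff 0 (T a b) ∘ h := by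
      funext t; simp [pullback]
    rw [h2]
    exact this.comp hh.continuousAt
  -- Invertibility is assumed at the origin only; continuity spreads it.
  have hdet : ∀ᶠ t in 𝓝 (0 : Fin 2 → ℂ),
      coeff 0 (pullback T h 0 0) t * coeff 0 (pullback T h 1 1) t
        - coeff 0 (pullback T h 0 1) t * coeff 0 (pullback T h 1 0) t ≠ 0 := by
    refine (((hc 0 0).mul (hc 1 1)).sub ((hc 0 1).mul (hc 1 0))).eventually_ne ?_
    simpa [pullback, h0, Matrix.det_fin_two] using H.invertible
  filter_upwards [e 0 0 0, e 0 1 0, e 1 0 0, hdet] with t e1 e2 e3 hd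
  simp [z, zz, Matrix.mul_apply, Matrix.vecMul, dotProduct, Fin.sum_univ_two] at e1 e2 e3
  simp only [coeff_zero_eq_constantCoeff] at hd ⊢
  generalize constantCoeff (pullback T h 0 0) t = a at *
  generalize constantCoeff (pullback T h 0 1) t = b at *
  generalize constantCoeff (pullback T h 1 0) t = c at *
  generalize constantCoeff (pullback T h 1 1) t = d at *
  generalize pdFun 1 (fun t => h t 0) t = p at *
  generalize pdFun 1 (fun t => h t 1) t = m at *
  -- If p ≠ 0, then p b = 0 and p a = b make the first row of T⁽⁰⁾ vanish.
  have hp : p = 0 := by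
    rcases e2 with hp | hb
    · exact hp
    · rcases mul_eq_zero.1 (show p * a = 0 by linear_combination e1 + hb) with hp | ha
      · exact hp
      · exact absurd (by rw [ha, hb]; ring) hd
  have hb : b = 0 := by linear_combination -e1 + a * hp
  have hdm : d = m * a := by linear_combination -e3 + c * hp
  refine ⟨hp, hb, ?_, ?_, hdm⟩ <;> rintro rfl <;> exact hd (by rw [hdm, hb]; ring)

/-- Order 1 of the upper right entry reads ∂₂b₀ + p b₁ + m (f∘h) d₀ = a₀ f̃. The first two terms
vanish, and d₀ = m a₀ supplies the second factor m. -/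
theorem IsFormalIso.quad_eq (H : IsFormalIso P.toTE Q.toTE h T) :
    ∀ᶠ t in 𝓝 (0 : Fin 2 → ℂ), pdFun 1 (fun t => h t 1) t ≠ 0 ∧
      pdFun 1 (fun t => h t 1) t ^ 2 * P.quad (h t) = Q.quad t := by
  -- Since b₀ vanishes near the origin, so does its derivative, which enters at order 1.
  have hb : coeff 0 (pullback T h 0 1) =ᶠ[𝓝 0] 0 :=
    H.eventually_leading.mono fun t ht => ht.2.1
  filter_upwards [H.eventually_leading, H.eq_t₂ 0 1 1, hb.fderiv (𝕜 := ℂ)] with t ht e hf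
  simp [z, zz, Matrix.mul_apply, Matrix.vecMul, dotProduct, Fin.sum_univ_two, pd, pdSeries,
    pdFun, mul_left_comm _ (X : FSeries 2), mul_assoc] at e
  obtain ⟨hp, hb0, ha, hm, hd⟩ := ht
  simp only [pdFun, coeff_zero_eq_constantCoeff] at hp hb0 ha hm hd hf ⊢
  refine ⟨hm, ?_⟩
  rw [hp, hf, fderiv_zero, hd] at e
  simp only [Pi.zero_apply, zero_apply] at e
  exact mul_right_cancel₀ ha (by linear_combination e)

end

/-! ### The z-equation at the origin: coefficient comparison and resonances -/

theorem coeff_mul_of_coeff_eq_zero {f g : ℂ⟦X⟧} {n : ℕ} (h : ∀ k < n, coeff k f = 0) :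
    coeff n (f * g) = coeff n f * coeff 0 g := by
  obtain ⟨f, rfl⟩ := X_pow_dvd_iff.2 h
  have e : ∀ p : ℂ⟦X⟧, coeff n (X ^ n * p) = coeff 0 p := fun p => by
    simpa using coeff_X_pow_mul p n 0
  rw [mul_assoc, e, e]
  simp

theorem coeff_X_mul_derivative (f : ℂ⟦X⟧) (n : ℕ) :
    coeff n (X * PowerSeries.derivative ℂ f) = n * coeff n f := by
  cases n with
  | zero => simp
  | succ n => rw [coeff_succ_X_mul, coeff_derivative]; push_cast; ring

/-- What a formal isomorphism imposes on the restrictions of two normal forms to the origin;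
`m` is the derivative at the origin of the base map in the direction of `t₂`. -/
structure OriginRelations (P Q : NormalForm) (m : ℂ) : Prop where
  m_ne : m ≠ 0
  cst : P.cst = Q.cst
  alpha : P.alpha = Q.alpha
  lower : coeff 0 P.lower = m * coeff 0 Q.lower
  upper : m * coeff 0 P.upper = coeff 0 Q.upper
  slope : coeff 0 P.upper = 0 → coeff 0 Q.lower = 0 → P.slope = Q.slope
  slope_sq : (∀ k < 2, coeff k P.upper = 0) → (∀ k < 2, coeff k Q.upper = 0) →
    coeff 0 Q.lower ≠ 0 → P.slope = Q.slope ∨ P.slope = -Q.slope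
  upper_resonant : ∀ n : ℕ, P.slope = n → Q.slope = n →
    (∀ k < n + 1, coeff k P.upper = 0) → (∀ k < n + 1, coeff k Q.upper = 0) →
    m * coeff (n + 1) P.upper = coeff (n + 1) Q.upper
  lower_resonant : ∀ n : ℕ, P.slope = -n → Q.slope = -n →
    (∀ k < n, coeff k P.lower = 0) → (∀ k < n, coeff k Q.lower = 0) →
    coeff n P.lower = m * coeff n Q.lower

/-- The system is X²T' + B T = T B̃ over ℂ⟦X⟧, with b₀ = 0 and d₀ = m a₀. Each relation comes from
an order at which the unknown higher coefficients of T cancel, followed by division by a₀ ≠ 0. -/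
theorem IsFormalIso.originRelations {P Q : NormalForm} {h : (Fin 2 → ℂ) → (Fin 2 → ℂ)}
    {T : FMat 2 2} (H : IsFormalIso P.toTE Q.toTE h T) :
    OriginRelations P Q (pdFun 1 (fun t => h t 1) 0) := by
  obtain ⟨-, hb, ha, hm, hd⟩ := H.eventually_leading.self_of_nhds
  have h0 := H.bihol.2.1
  have hT : ∀ i j, coeff 0 (pullback T h i j) 0 = coeff 0 (ev 0 (T i j)) := fun i j => by
    simp [coeff_ev, pullback, h0, - coeff_zero_eq_constantCoeff]
  rw [hT] at hb ha hd
  rw [hT] at hd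
  have e := H.eq_z_zero
  simp only [NormalForm.toTE, NormalForm.map_ev_B] at e
  have e00 := congr_fun₂ e 0 0
  have e01 := congr_fun₂ e 0 1
  have e10 := congr_fun₂ e 1 0
  have e11 := congr_fun₂ e 1 1
  clear e hT
  simp only [Matrix.add_apply, Matrix.smul_apply, Matrix.map_apply, Matrix.mul_apply,
    Fin.sum_univ_two, Matrix.of_apply, Matrix.cons_val_zero, Matrix.cons_val_one,
    Matrix.cons_val', Matrix.cons_val_fin_one, smul_eq_mul] at e00 e01 e10 e11
  generalize pdFun 1 (fun t => h t 1) 0 = m at *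
  generalize ev 0 (T 0 0) = a at *
  generalize ev 0 (T 0 1) = b at *
  generalize ev 0 (T 1 0) = c at *
  generalize ev 0 (T 1 1) = d at *
  obtain ⟨r, hr⟩ : ∃ r, r = (P.slope + 1) / 2 := ⟨_, rfl⟩
  obtain ⟨r', hr'⟩ : ∃ r, r = (Q.slope + 1) / 2 := ⟨_, rfl⟩
  rw [← hr, ← hr'] at e00 e01 e10 e11
  have hb' : ∀ k < 1, coeff k b = 0 := fun k hk => by rwa [Nat.lt_one_iff.1 hk]
  have z0 : ∀ f : ℂ⟦X⟧, coeff 0 (X * f) = 0 := fun f => by simp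
  have z1 : ∀ f : ℂ⟦X⟧, coeff 1 (X * f) = coeff 0 f := fun f => coeff_succ_X_mul 0 f
  have mul0 : ∀ f g : ℂ⟦X⟧, coeff 0 (f * g) = coeff 0 f * coeff 0 g := fun f g => by simp
  have hc : P.cst = Q.cst := by
    have := congr_arg (coeff 0) e00
    simp only [map_add, mul0, coeff_zero_C, coeff_zero_X, pow_two, hb] at this
    exact mul_right_cancel₀ ha (by linear_combination this)
  rw [hc] at e00 e01 e10 e11
  have low : coeff 0 P.lower = m * coeff 0 Q.lower := by
    have := congr_arg (coeff 0) e10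
    simp only [map_add, mul0, coeff_zero_C, coeff_zero_X, pow_two, hd] at this
    exact mul_right_cancel₀ ha (by linear_combination this)
  have f00 : X * (X * PowerSeries.derivative ℂ a + C (P.alpha - r) * a + P.upper * c) =
      X * (C (Q.alpha - r') * a) + b * Q.lower := by linear_combination e00
  have f11 : X * (X * PowerSeries.derivative ℂ d + C (P.alpha + r) * d) + b * P.lower =
      X * (C (Q.alpha + r') * d + Q.upper * c) := by linear_combination e11
  -- Once the constants c agree, every term of the upper right entry is divisible by X.
  have f01 : X * PowerSeries.derivative ℂ b + C (P.alpha - r) * b + P.upper * d =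
      Q.upper * a + C (Q.alpha + r') * b :=
    mul_left_cancel₀ X_ne_zero (by linear_combination e01)
  have upp : m * coeff 0 P.upper = coeff 0 Q.upper := by
    have := congr_arg (coeff 0) f01
    simp only [map_add, mul0, coeff_zero_C, coeff_zero_X, hb, hd] at this
    exact mul_right_cancel₀ ha (by linear_combination this)
  have g00 := congr_arg (coeff 1) f00
  have g11 := congr_arg (coeff 1) f11
  simp only [map_add, z1, mul0, coeff_zero_X, coeff_mul_of_coeff_eq_zero hb', coeff_zero_C, hd,
    low, ← upp] at g00 g11
  -- The unknowns b₁ and c₀ enter the two diagonal equations with opposite signs up to the factor m,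
  -- and so does r; they drop out of this combination.
  have hα : P.alpha = Q.alpha :=
    mul_right_cancel₀ (mul_ne_zero hm ha) (by linear_combination (m * g00 + g11) / 2)
  rw [hα] at f01 g00 e10
  have f01' : X * PowerSeries.derivative ℂ b + P.upper * d = Q.upper * a + C (r + r') * b := by
    simp only [map_add, map_sub] at f01 ⊢
    linear_combination f01
  have f10 : X * (X * PowerSeries.derivative ℂ c) + P.lower * a + X * (C (r + r') * c) =
      Q.lower * d := by
    simp only [map_add, map_sub] at e10 ⊢
    linear_combination e10
  refine ⟨hm, hc, hα, low, upp, fun hw hu => ?_, fun hw hw' hu => ?_, fun n hP hQ hw hw' => ?_,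
    fun n hP hQ hu hu' => ?_⟩
  · rw [hw, hu] at g00
    have : r = r' := mul_right_cancel₀ ha (by linear_combination -g00)
    linear_combination 2 * this - 2 * hr + 2 * hr'
  · have g01 := congr_arg (coeff 1) f01'
    have hv : ∀ k < 1, coeff k P.upper = 0 := fun k hk => hw k (by omega)
    have hv' : ∀ k < 1, coeff k Q.upper = 0 := fun k hk => hw' k (by omega)
    rw [map_add, map_add, coeff_X_mul_derivative, coeff_mul_of_coeff_eq_zero hv,
      coeff_mul_of_coeff_eq_zero hv', coeff_C_mul, hw 1 (by omega), hw' 1 (by omega)] at g01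
    rw [hw 0 (by omega)] at g00
    -- With no upper terms, order 1 reads b₁ = (r + r') b₁. Either b₁ = 0, or r + r' = 1, which is λ
    -- + λ̃ = 0.
    by_cases h1 : coeff 1 b = 0
    · left
      rw [h1] at g00
      -- Here the order 1 diagonal equation has lost both off-diagonal terms.
      have : r = r' := mul_right_cancel₀ ha (by linear_combination -g00)
      linear_combination 2 * this - 2 * hr + 2 * hr'
    · right
      have : r + r' = 1 := mul_right_cancel₀ h1 (by push_cast at g01; linear_combination -g01)
      linear_combination 2 * this - 2 * hr - 2 * hr'
  -- Now r + r' = n + 1, the factor that X d/dX puts on the coefficient of order n + 1, so that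
  -- coefficient of b cancels.
  · have g01 := congr_arg (coeff (n + 1)) f01'
    rw [map_add, map_add, coeff_X_mul_derivative, coeff_mul_of_coeff_eq_zero hw,
      coeff_mul_of_coeff_eq_zero hw', coeff_C_mul, hr, hr', hP, hQ, hd] at g01
    push_cast at g01
    exact mul_right_cancel₀ ha (by linear_combination g01)
  -- Now r + r' = 1 - n. The coefficient of c at order n - 1 has total factor (n - 1) + (1 - n) = 0.
  · have g10 := congr_arg (coeff n) f10
    rw [map_add, map_add, coeff_mul_of_coeff_eq_zero hu,
      coeff_mul_of_coeff_eq_zero hu', hr, hr', hP, hQ, hd] at g10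
    refine mul_right_cancel₀ ha ?_
    -- For n = 0 there is no coefficient of order n - 1: both terms in c carry a factor X.
    cases n with
    | zero => rw [z0, z0] at g10; linear_combination g10
    | succ n =>
      rw [coeff_succ_X_mul, coeff_succ_X_mul, coeff_X_mul_derivative, coeff_C_mul] at g10
      push_cast at g10
      linear_combination g10

/-- The relation m² (f∘h) = f̃ with m ≠ 0 transports vanishing; the inverse germ of h is needed to
recover f from f∘h. -/
theorem IsFormalIso.quad_eventually_zero_iff {P Q : NormalForm}
    {h : (Fin 2 → ℂ) → (Fin 2 → ℂ)} {T : FMat 2 2} (H : IsFormalIso P.toTE Q.toTE h T) :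
    P.quad =ᶠ[𝓝 0] 0 ↔ Q.quad =ᶠ[𝓝 0] 0 := by
  obtain ⟨hh, h0, g, hg, g0, -, hhg⟩ := H.bihol
  have th : Filter.Tendsto h (𝓝 0) (𝓝 0) := by simpa [h0] using hh.continuousAt.tendsto
  have tg : Filter.Tendsto g (𝓝 0) (𝓝 0) := by simpa [g0] using hg.continuousAt.tendsto
  constructor
  · intro hP
    filter_upwards [th.eventually hP, H.quad_eq] with t h1 h2
    rw [← h2.2, h1]
    simp
  · intro hQ
    have : ∀ᶠ t in 𝓝 0, P.quad (h t) = 0 := by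
      filter_upwards [hQ, H.quad_eq] with t h1 h2
      rw [h1] at h2
      simpa [h2.1] using h2.2
    filter_upwards [tg.eventually this, hhg] with t h1 h2
    rwa [h2] at h1

theorem not_eventually_pow_eq_zero (r : ℕ) :
    ¬ ∀ᶠ t in 𝓝 (0 : Fin 2 → ℂ), t 1 ^ r = 0 := by
  intro h
  have ht : Filter.Tendsto (fun s : ℂ => (fun _ => s : Fin 2 → ℂ)) (𝓝[≠] 0) (𝓝 0) := by
    refine Filter.Tendsto.mono_left ?_ nhdsWithin_le_nhds
    exact tendsto_pi_nhds.2 fun _ => Filter.tendsto_id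
  obtain ⟨s, hs, hs0⟩ := ((ht.eventually h).and self_mem_nhdsWithin).exists
  exact hs0 (eq_zero_of_pow_eq_zero hs)

/-! ### Comparing all pairs of normal forms -/

namespace NormalForm

/-- Whether the normal form has `A₂ = C₂`. -/
def IsIII : NormalForm → Prop
  | i _ _ _ | ii _ _ _ _ => False
  | _ => True

theorem quad_eventually_zero_iff (P : NormalForm) : P.quad =ᶠ[𝓝 0] 0 ↔ P.IsIII := by
  cases P
  case i =>
    simpa [IsIII, quad, Filter.EventuallyEq] using not_eventually_pow_eq_zero 0
  case ii r _ =>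
    simpa [IsIII, quad, Filter.EventuallyEq] using not_eventually_pow_eq_zero r
  all_goals simp [IsIII, quad]

/-- The value at the origin of the coefficient of `C₂` in `B`, at `z = 0`. -/
def lower₀ : NormalForm → ℂ
  | i _ _ c₀ => c₀
  | iii4 _ _ _ _ | iii5 _ _ _ _ _ => 1
  | _ => 0

/-- The value at the origin of the coefficient of `z E` in `B`, at `z = 0`. -/
def upper₀ : NormalForm → ℂ
  | i _ _ c₀ => c₀
  | _ => 0

theorem coeff_zero_lower (P : NormalForm) : coeff 0 P.lower = P.lower₀ := by
  cases P <;> simp [lower, lower₀]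
  omega

theorem coeff_zero_upper (P : NormalForm) : coeff 0 P.upper = P.upper₀ := by
  cases P <;> simp [upper, upper₀]

/-- Both uses rest on this bound: j = 2 for the slope relation, where n ≥ 1 is needed, and j = n + 1
for the resonance that detects γ. -/
theorem upper_iii5 (c α γ : ℂ) (n : ℕ) (hn : 1 ≤ n) (j : ℕ) (hj : j ≤ n + 1) :
    ∀ k < j, coeff k (iii5 c α γ n hn).upper = 0 := fun k hk => by
  simp [upper, coeff_X_pow, (hk.trans_le hj).ne]

end NormalForm

open NormalForm

/-- Equality here is of names with constants, so the coincidence of (iii.1) with (iii.3) at λ = 0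
appears as two extra alternatives. -/
theorem NormalForm.eq_or_exceptional {P Q : NormalForm} (H : FormallyIso P.toTE Q.toTE) :
    P = Q ∨ (∃ c α c₀, P = .i c α c₀ ∧ Q = .i c α (-c₀)) ∨
      (∃ c α l hl hl', P = .iii4 c α l hl ∧ Q = .iii4 c α (-l) hl') ∨
      (∃ c α hl, P = .iii1 c α ∧ Q = .iii3 c α 0 hl) ∨
      (∃ c α hl, P = .iii3 c α 0 hl ∧ Q = .iii1 c α) := by
  obtain ⟨h, T, H⟩ := H
  have hq : P.IsIII ↔ Q.IsIII := by
    rw [← quad_eventually_zero_iff, ← quad_eventually_zero_iff, H.quad_eventually_zero_iff]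
  obtain ⟨m, R⟩ : ∃ m, OriginRelations P Q m := ⟨_, H.originRelations⟩
  have hm := R.m_ne
  have hc := R.cst
  have hα := R.alpha
  have low := R.lower
  have upp := R.upper
  have hs := R.slope
  rw [coeff_zero_lower, coeff_zero_lower] at low
  rw [coeff_zero_upper, coeff_zero_upper] at upp
  rw [coeff_zero_upper, coeff_zero_lower] at hs
  clear H
  rcases P with ⟨c, α, c₀⟩ | ⟨c, α, r, hr⟩ | ⟨c, α⟩ | ⟨c, α⟩ | ⟨c, α, l, hl⟩ | ⟨c, α, l, hl⟩ |
    ⟨c, α, γ, n, hn⟩ | ⟨c, α, n, hn⟩ | ⟨c, α, n, hn⟩ | ⟨c, α, n, hn⟩ | ⟨c, α, n, hn⟩ <;>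
  rcases Q with ⟨c', α', c₀'⟩ | ⟨c', α', r', hr'⟩ | ⟨c', α'⟩ | ⟨c', α'⟩ | ⟨c', α', l', hl'⟩ |
    ⟨c', α', l', hl'⟩ | ⟨c', α', γ', n', hn'⟩ | ⟨c', α', n', hn'⟩ | ⟨c', α', n', hn'⟩ |
    ⟨c', α', n', hn'⟩ | ⟨c', α', n', hn'⟩ <;>
  simp only [IsIII, iff_true, iff_false, not_true_eq_false] at hq <;>
  simp only [NormalForm.cst, NormalForm.alpha] at hc hα <;> subst hc hα <;>
  simp only [lower₀, upper₀, NormalForm.slope, mul_zero, mul_one, one_ne_zero,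
    hm.symm, true_implies] at low upp hs
  -- Many pairs are settled by slopes: integers of different sign, or an integer against an excluded
  -- value of λ.
  all_goals
    try (have h1 : (n : ℂ) ≠ 0 := by exact_mod_cast (by omega))
    try (have h1' : (n' : ℂ) ≠ 0 := by exact_mod_cast (by omega))
    try exact absurd hs (by simpa using h1)
    try exact absurd hs (by simpa using h1.symm)
    try exact absurd hs (by simpa using h1')
    try exact absurd hs (by simpa using h1'.symm)
    try exact (hl' ⟨n, by omega, by simpa using hs.symm⟩).elim
    try exact (hl ⟨n', by omega, by simpa using hs⟩).elim
    try exact (hl' ⟨-n, by omega, by simpa using hs.symm⟩).elim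
    try exact (hl ⟨-n', by omega, by simpa using hs⟩).elim
    try (exfalso; have : (n : ℤ) = -n' := by exact_mod_cast hs
         omega)
    try (have : n = n' := by simpa using hs
         subst this)
  all_goals try exact .inl rfl
  case i.i =>
    rcases eq_or_ne c₀' 0 with rfl | h0
    · left; rw [low, mul_zero]
    -- c₀ = m c₀' and m c₀ = c₀' give m² = 1.
    · have : (m - 1) * (m + 1) = 0 :=
        mul_right_cancel₀ h0 (by linear_combination upp - m * low)
      rcases mul_eq_zero.1 this with h1 | h1
      · left; rw [low, sub_eq_zero.1 h1, one_mul]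
      · right; left
        exact ⟨c, α, c₀, rfl, by rw [low, eq_neg_of_add_eq_zero_left h1]; simp⟩
  case i.ii =>
    -- All of (ii) has u₀ = w₀ = 0, so c₀ = 0 and the slopes -1/2 and -1/(r'+2) must agree, against
    -- r' ≥ 1.
    have : (r' : ℂ) + 2 = 2 := by simpa using (hs low).symm
    simp at this
    omega
  case ii.i =>
    have : (r : ℂ) + 2 = 2 := by simpa using hs upp.symm
    simp at this
    omega
  case ii.ii =>
    have : r = r' := by simpa using hs
    subst this
    exact .inl rfl
  case iii1.iii2 =>
    -- The term -z²E of (iii.2) is the coefficient of w at order 1, the resonant order for slope 0.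
    have := R.upper_resonant 0 (by simp [NormalForm.slope]) (by simp [NormalForm.slope])
      (by simp [NormalForm.upper]) (by simp [NormalForm.upper])
    simp [NormalForm.upper] at this
  case iii1.iii3 =>
    subst hs
    exact .inr (.inr (.inr (.inl ⟨c, α, hl', rfl, rfl⟩)))
  case iii2.iii1 =>
    have := R.upper_resonant 0 (by simp [NormalForm.slope]) (by simp [NormalForm.slope])
      (by simp [NormalForm.upper]) (by simp [NormalForm.upper])
    simp [NormalForm.upper, hm] at this
  case iii2.iii3 =>
    subst hs
    have := R.upper_resonant 0 (by simp [NormalForm.slope]) (by simp [NormalForm.slope])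
      (by simp [NormalForm.upper]) (by simp [NormalForm.upper])
    simp [NormalForm.upper, hm] at this
  case iii3.iii1 =>
    subst hs
    exact .inr (.inr (.inr (.inr ⟨c, α, hl, rfl, rfl⟩)))
  case iii3.iii2 =>
    subst hs
    have := R.upper_resonant 0 (by simp [NormalForm.slope]) (by simp [NormalForm.slope])
      (by simp [NormalForm.upper]) (by simp [NormalForm.upper])
    simp [NormalForm.upper] at this
  case iii3.iii3 =>
    subst hs
    exact .inl rfl
  case iii4.iii4 =>
    rcases R.slope_sq (by simp [NormalForm.upper]) (by simp [NormalForm.upper])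
      (by simp [NormalForm.lower]) with h1 | h1 <;> simp only [NormalForm.slope] at h1
    · subst h1
      exact .inl rfl
    · obtain rfl : l' = -l := by rw [h1, neg_neg]
      exact .inr (.inr (.inl ⟨c, α, l, hl, hl', rfl, rfl⟩))
  case iii4.iii5 =>
    rcases R.slope_sq (by simp [NormalForm.upper]) (upper_iii5 c α γ' n' hn' 2 (by omega))
      (by simp [NormalForm.lower]) with h1 | h1 <;> simp only [NormalForm.slope] at h1
    · exact (hl ⟨n', by omega, by simpa using h1⟩).elim
    · exact (hl ⟨-n', by omega, by simpa using h1⟩).elim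
  case iii5.iii4 =>
    rcases R.slope_sq (upper_iii5 c α γ n hn 2 (by omega)) (by simp [NormalForm.upper])
      (by simp [NormalForm.lower]) with h1 | h1 <;> simp only [NormalForm.slope] at h1
    · exact (hl' ⟨n, by omega, by simpa using h1.symm⟩).elim
    · exact (hl' ⟨-n, by omega, by simp [h1]⟩).elim
  case iii5.iii5 =>
    rcases R.slope_sq (upper_iii5 c α γ n hn 2 (by omega)) (upper_iii5 c α γ' n' hn' 2 (by omega))
      (by simp [NormalForm.lower]) with h1 | h1 <;> simp only [NormalForm.slope] at h1
    · obtain rfl : n = n' := by exact_mod_cast h1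
      have := R.upper_resonant n rfl rfl (upper_iii5 c α γ n hn _ le_rfl)
        (upper_iii5 c α γ' n hn _ le_rfl)
      -- Both lower coefficients are 1, which forces m = 1, so γ is preserved exactly.
      simp only [NormalForm.upper, ← low, map_neg, coeff_C_mul, coeff_X_pow_self] at this
      obtain rfl : γ = γ' := by linear_combination -this
      exact .inl rfl
    · have : (n : ℤ) = -n' := by exact_mod_cast h1
      omega
  case iii6.iii7 =>
    have := R.upper_resonant n rfl rfl (by
      intro k hk; simp [NormalForm.upper, coeff_X_pow, hk.ne]) (by simp [NormalForm.upper])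
    simp [NormalForm.upper, hm] at this
  case iii7.iii6 =>
    have := R.upper_resonant n rfl rfl (by simp [NormalForm.upper]) (by
      intro k hk; simp [NormalForm.upper, coeff_X_pow, hk.ne])
    simp [NormalForm.upper] at this
  case iii8.iii9 =>
    have := R.lower_resonant n rfl rfl (by
      intro k hk; simp [NormalForm.lower, coeff_X_pow, hk.ne]) (by simp [NormalForm.lower])
    simp [NormalForm.lower] at this
  case iii9.iii8 =>
    have := R.lower_resonant n rfl rfl (by simp [NormalForm.lower]) (by
      intro k hk; simp [NormalForm.lower, coeff_X_pow, hk.ne])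
    simp [NormalForm.lower, hm.symm] at this

theorem FormalTE.same_of_eq {m r : ℕ} {N N' : FormalTE m r} (h : N = N') : N.Same N' := by
  subst h
  exact ⟨fun _ => GermEq.of_eq rfl, GermEq.of_eq rfl⟩

/-- Two names for one structure, hence no counterexample for distinct structures. -/
theorem NormalForm.B_iii3_zero (c α : ℂ) (hl) : (iii3 c α 0 hl).B = (iii1 c α).B := by
  have hk0 : (kk 0 : FSeries 2) = 0 := map_zero PowerSeries.C
  simp [B, hk0]

theorem NormalForm.same_or_exceptional {P Q : NormalForm} (H : FormallyIso P.toTE Q.toTE) :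
    P.toTE.Same Q.toTE ∨ (∃ c α c₀, P = .i c α c₀ ∧ Q = .i c α (-c₀)) ∨
      (∃ c α l hl hl', P = .iii4 c α l hl ∧ Q = .iii4 c α (-l) hl') := by
  rcases eq_or_exceptional H with rfl | h | h | ⟨c, α, hl, rfl, rfl⟩ | ⟨c, α, hl, rfl, rfl⟩
  · exact .inl (FormalTE.same_of_eq rfl)
  · exact .inr (.inl h)
  · exact .inr (.inr h)
  · exact .inl ⟨fun _ => GermEq.of_eq rfl, GermEq.of_eq (B_iii3_zero c α hl).symm⟩
  · exact .inl ⟨fun _ => GermEq.of_eq rfl, GermEq.of_eq (B_iii3_zero c α hl)⟩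

/-! ### An obstruction to gauge isomorphism -/

theorem NormalForm.coeff_zero_B_diag (P : NormalForm) (t : Fin 2 → ℂ) :
    coeff 0 (P.B 0 0) t = -t 0 + P.cst ∧ coeff 0 (P.B 1 1) t = -t 0 + P.cst := by
  cases P <;> simp [B, C₁, C₂, D, E, cst, z, zz, kk, t₁, t₂, tt]

theorem pdFun_comp_apply {φ : ℂ → ℂ} {φ' : ℂ} {t : Fin 2 → ℂ} {j : Fin 2}
    (h : HasDerivAt φ φ' (t j)) (i : Fin 2) :
    pdFun i (fun t => φ (t j)) t = if j = i then φ' else 0 := by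
  have h1 := (ContinuousLinearMap.proj (R := ℂ) (φ := fun _ : Fin 2 => ℂ) j).hasFDerivAt (x := t)
  have h2 : HasFDerivAt (fun t : Fin 2 → ℂ => φ (t j)) _ t := h.hasFDerivAt.comp t h1
  rw [pdFun, h2.fderiv]
  by_cases hj : j = i <;> simp [hj]

/-- A gauge isomorphism preserves the coefficient of `C₂` in `B` at `z = 0`. -/
theorem FormallyGaugeIso.coeff_zero_B_eq {P Q : NormalForm}
    (H : FormallyGaugeIso P.toTE Q.toTE) :
    coeff 0 (P.B 1 0) =ᶠ[𝓝 0] coeff 0 (Q.B 1 0) := by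
  obtain ⟨T, H⟩ := H
  have hc := H.originRelations.cst
  have hid : ∀ F : FMat 2 2, pullback F id = F := fun F => by
    ext; simp [pullback]
  filter_upwards [H.eventually_leading, H.eq_z 1 0 0] with t h1 h2
  have hm : pdFun 1 (fun t : Fin 2 → ℂ => id t 1) t = 1 := by
    simpa using pdFun_comp_apply (φ := id) (t := t) (j := 1) (hasDerivAt_id _) 1
  obtain ⟨-, -, ha, -, hd⟩ := h1
  rw [hm, one_mul] at hd
  have hP := (P.coeff_zero_B_diag t).2
  have hQ := (Q.coeff_zero_B_diag t).1
  simp only [hid] at h2 hd ha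
  simp [NormalForm.toTE, Matrix.mul_apply, zz] at h2
  simp only [coeff_zero_eq_constantCoeff] at *
  rw [hP, hQ, hc, hd] at h2
  -- At z = 0 both diagonals of B equal -t₁ + c, so the terms in c₀ of T cancel; a₀ = d₀ since m =
  -- 1.
  exact mul_right_cancel₀ ha (by linear_combination h2)

/-! ### The isomorphism in case (i) -/

theorem ev_pdSeries_C (f : (Fin 2 → ℂ) → ℂ) (i : Fin 2) (t : Fin 2 → ℂ) :
    ev t (pdSeries i (C f)) = C (pdFun i f t) := by
  ext n
  by_cases hn : n = 0
  · simp [coeff_ev, pdSeries, hn]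
  · simp only [coeff_ev, pdSeries, coeff_mk, coeff_C, hn, if_false]
    change fderiv ℂ (fun _ => (0 : ℂ)) t _ = 0
    simp

/-- The map `(t₁, t₂) ↦ (t₁, -t₂)`. -/
def reflect (t : Fin 2 → ℂ) : Fin 2 → ℂ := ![t 0, -t 1]

theorem analyticAt_vec {f g : (Fin 2 → ℂ) → ℂ} {t : Fin 2 → ℂ} (hf : AnalyticAt ℂ f t)
    (hg : AnalyticAt ℂ g t) : AnalyticAt ℂ (fun t => ![f t, g t]) t := by
  refine analyticAt_pi_iff.2 fun i => ?_
  fin_cases i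
  · exact hf
  · exact hg

theorem analyticAt_apply (j : Fin 2) (t : Fin 2 → ℂ) :
    AnalyticAt ℂ (fun t : Fin 2 → ℂ => t j) t :=
  (ContinuousLinearMap.proj (R := ℂ) (φ := fun _ : Fin 2 => ℂ) j).analyticAt t

theorem isBiholGerm_reflect : IsBiholGerm reflect := by
  have h1 : AnalyticAt ℂ reflect 0 := analyticAt_vec (analyticAt_apply 0 0) (analyticAt_apply 1 0).neg
  have h0 : reflect 0 = 0 := by ext i; fin_cases i <;> simp [reflect]
  have hr : ∀ t, reflect (reflect t) = t := fun t => by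
    ext i; fin_cases i <;> simp [reflect]
  exact ⟨h1, h0, reflect, h1, h0, .of_forall hr, .of_forall hr⟩

/-- Conjugation by D fixes C₁ and D and negates C₂ and E. The sign is absorbed by dt₂ ↦ -dt₂ in A₂
and, in B, by t₂ ↦ -t₂ together with c₀ ↦ -c₀. -/
theorem isFormalIso_i (c α c₀ : ℂ) :
    IsFormalIso (NormalForm.i c α c₀).toTE (NormalForm.i c α (-c₀)).toTE reflect D where
  bihol := isBiholGerm_reflect
  hol := IsHol.of_entire fun a b => by
    fin_cases a <;> fin_cases b
    · exact entire_one
    · exact entire_zero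
    · exact entire_zero
    · exact entire_one.neg
  invertible := by simp [D, Matrix.det_fin_two]
  eq_t i := by
    refine GermEq.of_eventually (.of_forall fun t => ?_)
    have hD : pullback D reflect = D := by
      ext a b n t; fin_cases a <;> fin_cases b <;> by_cases hn : n = 0 <;>
        simp [pullback, D, coeff_one, hn]
    have hpd : pd i D = 0 := by
      refine Matrix.ext fun a b => ?_
      fin_cases a <;> fin_cases b
      · exact hasPd_one.2
      · exact hasPd_zero.2
      · exact hasPd_zero.2
      · exact (hasPd_one.neg.congr neg_zero).2
    have p0 : pdFun i (fun t => reflect t 0) t = if (0 : Fin 2) = i then 1 else 0 :=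
      pdFun_comp_apply (j := 0) (hasDerivAt_id _) i
    have p1 : pdFun i (fun t => reflect t 1) t = if (1 : Fin 2) = i then -1 else 0 :=
      pdFun_comp_apply (j := 1) (hasDerivAt_id _).neg i
    rw [Matrix.map_sub _ (map_sub _), Matrix.map_add _ (map_add _), Matrix.map_mul, hD, hpd,
      Fin.sum_univ_two, Matrix.map_add _ (map_add _)]
    simp only [map_ev_smul, map_ev_zero, Matrix.map_mul, map_ev_pullback, ev_C, p0, p1]
    refine Matrix.ext fun a b => ?_
    fin_cases i <;> fin_cases a <;> fin_cases b <;>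
    simp [Matrix.mul_apply, NormalForm.toTE, NormalForm.A₂, C₁, C₂, D, E, ev_z]
  eq_z := by
    refine GermEq.of_eventually (.of_forall fun t => ?_)
    rw [Matrix.map_sub _ (map_sub _), Matrix.map_add _ (map_add _), Matrix.map_mul,
      Matrix.map_mul, map_ev_smul, map_ev_dz, map_ev_pullback, map_ev_pullback, map_ev_zero]
    refine Matrix.ext fun a b => ?_
    fin_cases a <;> fin_cases b <;>
    simp [Matrix.mul_apply, NormalForm.toTE, NormalForm.B, C₁, C₂, D, E, ev_z, ev_kk, ev_t₁, ev_t₂,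
      reflect] <;> ring

/-! ### The isomorphism in case (iii.4) -/

/-- The map `(t₁, t₂) ↦ (t₁, t₂ / (1 - l t₂))`. -/
def moebius (l : ℂ) (t : Fin 2 → ℂ) : Fin 2 → ℂ := ![t 0, t 1 / (1 - l * t 1)]

theorem eventually_one_sub_ne (l : ℂ) : ∀ᶠ t in 𝓝 (0 : Fin 2 → ℂ), 1 - l * t 1 ≠ 0 := by
  have : ContinuousAt (fun t : Fin 2 → ℂ => 1 - l * t 1) 0 :=
    continuousAt_const.sub (continuousAt_const.mul (continuous_apply 1).continuousAt)
  exact this.eventually_ne (by simp)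

theorem analyticAt_moebius (l : ℂ) : AnalyticAt ℂ (moebius l) 0 :=
  analyticAt_vec (analyticAt_apply 0 0) ((analyticAt_apply 1 0).div
    (analyticAt_const.sub (analyticAt_const.mul (analyticAt_apply 1 0))) (by simp))

theorem moebius_zero (l : ℂ) : moebius l 0 = 0 := by
  ext i; fin_cases i <;> simp [moebius]

theorem one_add_mul_moebius {l s : ℂ} (h : 1 - l * s ≠ 0) :
    1 + l * (s / (1 - l * s)) = (1 - l * s)⁻¹ := by
  field_simp
  ring

theorem moebius_neg_moebius (l : ℂ) :
    ∀ᶠ t in 𝓝 (0 : Fin 2 → ℂ), moebius (-l) (moebius l t) = t := by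
  filter_upwards [eventually_one_sub_ne l] with t ht
  have h1 := one_add_mul_moebius ht
  ext i
  fin_cases i
  · simp [moebius]
  · simp only [moebius, Fin.mk_one, Matrix.cons_val_one, Matrix.cons_val_fin_one, neg_mul,
      sub_neg_eq_add, h1, div_inv_eq_mul, div_mul_cancel₀ _ ht]

theorem isBiholGerm_moebius (l : ℂ) : IsBiholGerm (moebius l) :=
  ⟨analyticAt_moebius l, moebius_zero l, moebius (-l), analyticAt_moebius _, moebius_zero _,
    moebius_neg_moebius l, by simpa using moebius_neg_moebius (-l)⟩

/-- The isomorphism covering `moebius l` between the normal forms `iii4` for `l` and `-l`. -/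
def moebiusGauge (l : ℂ) : FMat 2 2 :=
  !![C fun t => (1 + l * t 1)⁻¹, kk (-l) * z; 0, C fun t => 1 + l * t 1]

theorem pullback_moebiusGauge (l : ℂ) :
    pullback (moebiusGauge l) (moebius l) =
      !![C fun t => (1 + l * (t 1 / (1 - l * t 1)))⁻¹, kk (-l) * z;
        0, C fun t => 1 + l * (t 1 / (1 - l * t 1))] := by
  refine Matrix.ext fun a b => PowerSeries.ext fun n => funext fun t => ?_
  fin_cases a <;> fin_cases b
  · by_cases hn : n = 0 <;> simp [pullback, moebiusGauge, coeff_C, hn, moebius]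
  · by_cases hn : n = 1 <;> simp [pullback, moebiusGauge, kk, z, zz, coeff_X, hn]
  · simp [pullback, moebiusGauge]
  · by_cases hn : n = 0 <;> simp [pullback, moebiusGauge, coeff_C, hn, moebius]

theorem hasDerivAt_moebius {l s : ℂ} (h : 1 - l * s ≠ 0) :
    HasDerivAt (fun s => s / (1 - l * s)) (((1 - l * s) ^ 2)⁻¹) s := by
  have h1 : HasDerivAt (fun s => 1 - l * s) (-l) s := by
    simpa using ((hasDerivAt_id s).const_mul l).const_sub 1
  refine ((hasDerivAt_id s).div h1 h).congr_deriv ?_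
  rw [inv_eq_one_div]
  congr 1
  simp
  ring

theorem isHol_moebiusGauge (l : ℂ) : IsHol (moebiusGauge l) := by
  refine ⟨{t | 1 + l * t 1 ≠ 0}, ?_, fun a b n t ht => ?_⟩
  · filter_upwards [eventually_one_sub_ne (-l)] with t ht
    simpa using ht
  have hf : AnalyticAt ℂ (fun t : Fin 2 → ℂ => 1 + l * t 1) t :=
    analyticAt_const.add (analyticAt_const.mul (analyticAt_apply 1 t))
  have h0 : AnalyticAt ℂ (0 : (Fin 2 → ℂ) → ℂ) t := analyticAt_const
  fin_cases a <;> fin_cases b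
  · by_cases hn : n = 0
    · simpa [moebiusGauge, hn] using hf.fun_inv ht
    · simpa [moebiusGauge, hn, coeff_C] using h0
  · exact ((entire_kk (-l)).mul entire_zz) n t trivial
  · exact entire_zero n t trivial
  · by_cases hn : n = 0
    · simpa [moebiusGauge, hn] using hf
    · simpa [moebiusGauge, hn, coeff_C] using h0

theorem map_ev_pullback_moebiusGauge {l : ℂ} {t : Fin 2 → ℂ} (ht : 1 - l * t 1 ≠ 0) :
    (pullback (moebiusGauge l) (moebius l)).map (ev t) =
      !![C (1 - l * t 1), C (-l) * X; 0, C (1 - l * t 1)⁻¹] := by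
  rw [pullback_moebiusGauge]
  refine Matrix.ext fun a b => ?_
  fin_cases a <;> fin_cases b <;> simp [ev_C, ev_z, ev_kk, one_add_mul_moebius ht]

theorem map_ev_pd_moebiusGauge {l : ℂ} {t : Fin 2 → ℂ} (ht : 1 - l * t 1 ≠ 0) (i : Fin 2) :
    (pd i (pullback (moebiusGauge l) (moebius l))).map (ev t) =
      if 1 = i then !![C (-l), 0; 0, C (l * ((1 - l * t 1) ^ 2)⁻¹)] else 0 := by
  have hμ := hasDerivAt_moebius ht
  have h11 := (hμ.const_mul l).const_add 1
  -- Near this point the function is just 1 - ls.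
  have h00 : HasDerivAt (fun s => (1 + l * (s / (1 - l * s)))⁻¹) (-l) (t 1) := by
    have h1 : HasDerivAt (fun s => 1 - l * s) (-l) (t 1) := by
      simpa using ((hasDerivAt_id (t 1)).const_mul l).const_sub 1
    refine h1.congr_of_eventuallyEq ?_
    filter_upwards [h1.continuousAt.eventually_ne ht] with s hs
    rw [one_add_mul_moebius hs, inv_inv]
  have h01 : pdSeries i (kk (-l) * z) = 0 :=
    (((hasPd_kk (-l)).mul (hasPd_zz (m := 2) (i := i))).congr (by simp)).2
  rw [pullback_moebiusGauge]
  refine Matrix.ext fun a b => ?_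
  fin_cases a <;> fin_cases b
  · simp [pd, ev_pdSeries_C, pdFun_comp_apply h00]; split_ifs <;> simp
  · simp [pd, h01]; split_ifs <;> simp
  · simp [pd, hasPd_zero.2]; split_ifs <;> simp
  · simp [pd, ev_pdSeries_C, pdFun_comp_apply h11]; split_ifs <;> simp

theorem map_ev_C₂ (t : Fin 2 → ℂ) : C₂.map (ev t) = !![0, 0; 1, 0] := by
  refine Matrix.ext fun a b => ?_
  fin_cases a <;> fin_cases b <;> simp [C₂]

theorem map_ev_B_iii4 (c α l : ℂ) (hl) (t : Fin 2 → ℂ) :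
    (NormalForm.iii4 c α l hl).B.map (ev t) =
      !![-C (t 0) + C c + C α * X - C (1 / 2) * X * (C l + 1), 0;
        C l * C (t 1) + 1, -C (t 0) + C c + C α * X + C (1 / 2) * X * (C l + 1)] := by
  refine Matrix.ext fun a b => ?_
  fin_cases a <;> fin_cases b <;>
    simp [NormalForm.B, C₁, C₂, D, ev_z, ev_kk, ev_t₁, ev_t₂]

/-- With d₀ = m a₀, order 0 of the z-equation asks for λφ + 1 = (1 - λt₂) φ' where h² = φ(t₂); its
solution with φ(0) = 0 and φ'(0) = 1 is the Möbius map. Taking a = 1 - λt₂ and c = 0, the diagonal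
entries of the t₂-equation give b = z ∂₂a = -λz and agree with d = 1/(1 - λt₂). For λ ≠ 0 this has
b₁ ≠ 0, the branch of the slope relation with opposite signs. -/
theorem isFormalIso_iii4 (c α l : ℂ) (hl hl') :
    IsFormalIso (NormalForm.iii4 c α l hl).toTE (NormalForm.iii4 c α (-l) hl').toTE
      (moebius l) (moebiusGauge l) where
  bihol := isBiholGerm_moebius l
  hol := isHol_moebiusGauge l
  invertible := by simp [moebiusGauge, Matrix.det_fin_two]
  eq_t i := by
    refine GermEq.of_eventually ?_
    filter_upwards [eventually_one_sub_ne l] with t ht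
    have p0 : pdFun i (fun t => moebius l t 0) t = if (0 : Fin 2) = i then 1 else 0 :=
      pdFun_comp_apply (j := 0) (hasDerivAt_id _) i
    have p1 : pdFun i (fun t => moebius l t 1) t = if (1 : Fin 2) = i then _ else 0 :=
      pdFun_comp_apply (j := 1) (hasDerivAt_moebius ht) i
    rw [Matrix.map_sub _ (map_sub _), Matrix.map_add _ (map_add _), Matrix.map_mul,
      Fin.sum_univ_two, Matrix.map_add _ (map_add _), map_ev_smul, map_ev_smul, map_ev_smul,
      Matrix.map_mul, Matrix.map_mul, map_ev_pd_moebiusGauge ht, map_ev_pullback_moebiusGauge ht,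
      map_ev_zero, ev_C, ev_C, p0, p1, map_ev_pullback, map_ev_pullback]
    have hq : C (1 - l * t 1) * C (1 - l * t 1)⁻¹ = (1 : ℂ⟦X⟧) := by
      rw [← map_mul, mul_inv_cancel₀ ht, map_one]
    have hq2 : C ((1 - l * t 1) ^ 2)⁻¹ = (C (1 - l * t 1)⁻¹ ^ 2 : ℂ⟦X⟧) := by
      rw [← map_pow, inv_pow]
    generalize 1 - l * t 1 = q at *
    refine Matrix.ext fun a b => ?_
    fin_cases i <;> fin_cases a <;> fin_cases b <;>
      simp [NormalForm.toTE, NormalForm.A₂, C₁, map_ev_C₂, ev_zz, hq2]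
    · ring
    · linear_combination C q⁻¹ * hq
    · ring
  eq_z := by
    refine GermEq.of_eventually ?_
    filter_upwards [eventually_one_sub_ne l] with t ht
    rw [Matrix.map_sub _ (map_sub _), Matrix.map_add _ (map_add _), Matrix.map_mul,
      Matrix.map_mul, map_ev_smul, map_ev_dz, map_ev_pullback_moebiusGauge ht, map_ev_pullback,
      map_ev_zero]
    simp only [NormalForm.toTE, map_ev_B_iii4]
    have hq : (1 - C l * C (t 1)) * C (1 - l * t 1)⁻¹ = (1 : ℂ⟦X⟧) := by
      rw [← map_mul, ← map_one C, ← map_sub, ← map_mul, mul_inv_cancel₀ ht]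
    have hh : (2 * C (1 / 2) : ℂ⟦X⟧) = 1 := by
      rw [← map_ofNat C 2, ← map_mul, ← map_one C]; norm_num
    refine Matrix.ext fun a b => ?_
    fin_cases a <;> fin_cases b <;>
      simp [moebius, ev_zz, div_eq_mul_inv] <;>
      simp only [one_div] at hh
    all_goals generalize (C (1 - l * t 1)⁻¹ : ℂ⟦X⟧) = p at *
    · linear_combination -(1 - C l * C (t 1)) * X * C l * hh
    · linear_combination X ^ 2 * C l * hh
    · linear_combination C l * C (t 1) * hq - hq
    · linear_combination C l * X * p * hh + C l * X * hq

end TEStruct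

end

/-! ### Assembly -/

theorem theorem3p2 :
    -- distinct normal forms are formally non-isomorphic, outside the two exceptional cases
    (∀ P Q : TEStruct.NormalForm,
      ¬ P.toTE.Same Q.toTE →
      ¬ (∃ c α c₀ c' α' c₀' : ℂ, c₀ * c₀' ≠ 0 ∧
          P = TEStruct.NormalForm.i c α c₀ ∧ Q = TEStruct.NormalForm.i c' α' c₀') →
      ¬ (∃ (c α l : ℂ) (hl : ¬ ∃ n : ℤ, n ≠ 0 ∧ l = n)
            (c' α' l' : ℂ) (hl' : ¬ ∃ n : ℤ, n ≠ 0 ∧ l' = n), l * l' ≠ 0 ∧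
          P = TEStruct.NormalForm.iii4 c α l hl ∧ Q = TEStruct.NormalForm.iii4 c' α' l' hl') →
      ¬ TEStruct.FormallyIso P.toTE Q.toTE) ∧
    -- first exceptional case: both of the form `i`, with nonzero `c₀`, `c₀'`
    (∀ c α c₀ c' α' c₀' : ℂ, c₀ * c₀' ≠ 0 →
      ¬ (TEStruct.NormalForm.i c α c₀).toTE.Same (TEStruct.NormalForm.i c' α' c₀').toTE →
      (TEStruct.FormallyIso (TEStruct.NormalForm.i c α c₀).toTE
          (TEStruct.NormalForm.i c' α' c₀').toTE ↔
        c' = c ∧ α' = α ∧ c₀' = -c₀) ∧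
      ¬ TEStruct.FormallyGaugeIso (TEStruct.NormalForm.i c α c₀).toTE
          (TEStruct.NormalForm.i c' α' c₀').toTE) ∧
    -- second exceptional case: both of the form `iii4`, with nonzero `l`, `l'`
    (∀ (c α l : ℂ) (hl : ¬ ∃ n : ℤ, n ≠ 0 ∧ l = n)
        (c' α' l' : ℂ) (hl' : ¬ ∃ n : ℤ, n ≠ 0 ∧ l' = n), l * l' ≠ 0 →
      ¬ (TEStruct.NormalForm.iii4 c α l hl).toTE.Same
          (TEStruct.NormalForm.iii4 c' α' l' hl').toTE →
      (TEStruct.FormallyIso (TEStruct.NormalForm.iii4 c α l hl).toTE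
          (TEStruct.NormalForm.iii4 c' α' l' hl').toTE ↔
        c' = c ∧ α' = α ∧ l' = -l) ∧
      ¬ TEStruct.FormallyGaugeIso (TEStruct.NormalForm.iii4 c α l hl).toTE
          (TEStruct.NormalForm.iii4 c' α' l' hl').toTE) := by
  refine ⟨fun P Q hS hi hiii H => ?_, fun c α c₀ c' α' c₀' h0 hS => ⟨⟨fun H => ?_, ?_⟩, fun H => ?_⟩,
    fun c α l hl c' α' l' hl' h0 hS => ⟨⟨fun H => ?_, ?_⟩, fun H => ?_⟩⟩
  · rcases TEStruct.NormalForm.same_or_exceptional H with h | ⟨c, α, c₀, rfl, rfl⟩ |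
      ⟨c, α, l, hl, hl', rfl, rfl⟩
    · exact hS h
    -- The sign change is trivial when the constant is 0, so the structures would not be distinct.
    · rcases eq_or_ne c₀ 0 with rfl | h0
      · exact hS (by rw [neg_zero]; exact TEStruct.FormalTE.same_of_eq rfl)
      · exact hi ⟨c, α, c₀, c, α, -c₀, by simpa using h0, rfl, rfl⟩
    · rcases eq_or_ne l 0 with rfl | h0
      · exact hS (TEStruct.FormalTE.same_of_eq (by simp only [neg_zero]))
      · exact hiii ⟨c, α, l, hl, c, α, -l, hl', by simpa using h0, rfl, rfl⟩
  · rcases TEStruct.NormalForm.same_or_exceptional H with h | ⟨d, δ, d₀, h1, h2⟩ |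
      ⟨d, δ, l, hl, hl', h1, h2⟩
    · exact absurd h hS
    · cases h1; cases h2; exact ⟨rfl, rfl, rfl⟩
    · cases h1
  · rintro ⟨rfl, rfl, rfl⟩
    exact ⟨_, _, TEStruct.isFormalIso_i _ _ _⟩
  · obtain ⟨T, hT⟩ := id H
    have hc : c = c' := hT.originRelations.cst
    have hα : α = α' := hT.originRelations.alpha
    have h1 := H.coeff_zero_B_eq.eq_of_nhds
    have h2 : c₀ = c₀' := by
      simpa [TEStruct.NormalForm.B, TEStruct.C₁, TEStruct.C₂, TEStruct.D, TEStruct.E,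
        TEStruct.kk, TEStruct.t₂, TEStruct.tt] using h1
    subst hc hα h2
    exact hS (TEStruct.FormalTE.same_of_eq rfl)
  · rcases TEStruct.NormalForm.same_or_exceptional H with h | ⟨d, δ, d₀, h1, h2⟩ |
      ⟨d, δ, l, hl, hl', h1, h2⟩
    · exact absurd h hS
    · cases h1
    · cases h1; cases h2; exact ⟨rfl, rfl, rfl⟩
  · rintro ⟨rfl, rfl, rfl⟩
    exact ⟨_, _, TEStruct.isFormalIso_iii4 _ _ _ _ _⟩
  · obtain ⟨T, hT⟩ := id H
    have hc : c = c' := hT.originRelations.cst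
    have hα : α = α' := hT.originRelations.alpha
    have h2 : l = l' := by
      by_contra hne
      -- If λ ≠ λ', equality of the C₂-coefficients λt₂ + 1 near the origin would force t₂ = 0
      -- there.
      refine TEStruct.not_eventually_pow_eq_zero 1 (H.coeff_zero_B_eq.mono fun t ht => ?_)
      have h3 : l = l' ∨ t 1 = 0 := by
        simpa [TEStruct.NormalForm.B, TEStruct.C₁, TEStruct.C₂, TEStruct.D,
          TEStruct.kk, TEStruct.t₂, TEStruct.tt] using ht
      simpa using h3.resolve_left hne
    subst hc hα h2
    exact hS (TEStruct.FormalTE.same_of_eq rfl)
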